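/- A 3-restricted star colouring (3-rs colouring) of a graph $G$ is a map $f:V(G)\to\{0,1,2\}$ such that $f(x)\neq f(y)$ for every edge $xy$, and there is no path $x,y,z$ in $G$ with $f(y)>f(x)=f(z)$. A graph is chordal if it has no induced cycle of length greater than three. **Theorem (3-RS Colourability is in P for chordal graphs).** There are a deterministic multitape (finitely many stacks) Turing machine $M$ and a function $T:\mathbb{N}\to\mathbb{N}$ with $T(n)=O(n^3)$ such that, for every $n$ and every chordal graph $G$ on $n$ vertices, $M$, given the adjacency matrix of $G$ (written row by row) as input, halts within $T(n)$ steps and answers whether $G$ has a 3-rs colouring. In particular, the problem of deciding, for a given chordal graph, whether it is 3-rs colourable is solvable in time polynomial in the length of the input. -/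

import Mathlib

namespace RSCol

/-- A `k`-restricted star colouring: a proper colouring with colours `0, …, k - 1` such that no
path `x, y, z` has `f y > f x = f z`. -/
structure IsRSColouring {V : Type*} (G : SimpleGraph V) {k : ℕ} (f : V → Fin k) : Prop where
  proper : ∀ x y, G.Adj x y → f x ≠ f y
  restricted : ∀ x y z, G.Adj x y → G.Adj y z → x ≠ z → f x = f z → ¬ f x < f y

/-- `G` is `k`-rs colourable. -/
def RSColourable {V : Type*} (G : SimpleGraph V) (k : ℕ) : Prop :=
  ∃ f : V → Fin k, IsRSColouring G f

/-- A graph is chordal if it has no induced cycle of length greater than three. -/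
def IsChordal {V : Type*} (G : SimpleGraph V) : Prop :=
  ∀ m : ℕ, 3 < m → ¬ (SimpleGraph.cycleGraph m).IsIndContained G

open Classical in
/-- The adjacency matrix of a graph on `{0, …, n - 1}`, written row by row as a word: an entry is
the letter `some true` or `some false`, and the letter `none` ends each row. -/
noncomputable def encodeGraph {n : ℕ} (G : SimpleGraph (Fin n)) : List (Option Bool) :=
  (List.finRange n).flatMap fun i =>
    (List.finRange n).map (fun j => some (decide (G.Adj i j))) ++ [none]

/-- The instances of a decision problem restricted to chordal graphs: a number `n` of vertices
and a chordal graph on `{0, …, n - 1}`. -/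
def ChordalInstance : Type := Σ n : ℕ, {G : SimpleGraph (Fin n) // IsChordal G}

/-- The word that presents an instance to a machine. -/
noncomputable def ChordalInstance.encode (I : ChordalInstance) : List (Option Bool) :=
  encodeGraph I.2.1

open Classical in
/-- The answer of `k`-RS Colourability on an instance. -/
noncomputable def ChordalInstance.answer (k : ℕ) (I : ChordalInstance) : Bool :=
  decide (RSColourable I.2.1 k)

/-- The machine `M` (a deterministic Turing machine with finitely many stacks), started on the
encoding of any chordal graph with `n` vertices, halts within `T n` steps, and its output is
the answer of `k`-RS Colourability. -/
def DecidesChordalInTime (k : ℕ) (M : Turing.TM2ComputableAux (Option Bool) Bool)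
    (T : ℕ → ℕ) : Prop :=
  ∀ I : ChordalInstance, Nonempty (Turing.TM2OutputsInTime M.tm
    (I.encode.map M.inputAlphabet.invFun)
    (some ((Computability.encodeBool (I.answer k)).map M.outputAlphabet.invFun)) (T I.1))

end RSCol

/-! The neighbours of smaller colour of a vertex have distinct colours. So a vertex of colour 2 has
at most two neighbours, and a vertex of colour 2 in a triangle has degree exactly two (an ear).
Every triangle uses colour 2, hence contains an ear. A finite chordal graph of minimum degree at
least two contains a triangle, since a shortest cycle is induced (`IsChordal.exists_triangle`). Thus
a nonempty colourable chordal graph has an ear or a vertex of degree at most one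
(`Sat.exists_leaf_or_ear`).

Such vertices are deleted one by one. Each remaining vertex keeps a table of states: a colour
together with the smaller colours already used by deleted neighbours. A vertex of degree at most one
hands its whole table to its neighbour (`sat_remove_leaf_iff`). An ear may be assumed to have colour
2 (`sat_remove_ear_iff`): if another vertex of its triangle has colour 2, that vertex has degree two
as well, so the two are twins and can exchange states. The exchange needs equal tables. This holds
because a vertex that has absorbed a neighbour cannot have colour 2 beside two further neighbours
(`not_allowsTwo_absorb`), so both tables are still the initial one. If vertices remain but none can
be deleted, there is no colouring.

The machine keeps the matrix on a stack and performs each round in O(n^2) steps. A round deletes a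
vertex, or marks a vertex of degree two as lying in no triangle; the mark stays correct because
deletions create no triangles. Each vertex is treated at most twice, so there are at most 2n such
rounds, and O(n^3) steps in all. -/

namespace RSCol

open Finset

/-! ### Cycles in chordal graphs -/

section Cycles

variable {V : Type*} {G : SimpleGraph V}

/-- The first `m` values of `c` run through a cycle of `G` inside `W`. -/
structure IsCycleSeq (G : SimpleGraph V) (W : Set V) (m : ℕ) (c : ℕ → V) : Prop where
  three_le : 3 ≤ m
  mem : ∀ i < m, c i ∈ W
  inj : ∀ i < m, ∀ j < m, c i = c j → i = j
  adj : ∀ i, i + 1 < m → G.Adj (c i) (c (i + 1))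
  closed : G.Adj (c (m - 1)) (c 0)

theorem cycleGraph_adj_of_lt {m : ℕ} {i j : Fin m} (hij : i < j) :
    (SimpleGraph.cycleGraph m).Adj i j ↔
      j.val = i.val + 1 ∨ (i.val = 0 ∧ j.val = m - 1) := by
  rw [SimpleGraph.cycleGraph_adj', Fin.sub_def, Fin.sub_def]
  have hi := i.2
  have hj := j.2
  have h : i.val < j.val := hij
  simp only
  rw [show m - i.val + j.val = (j.val - i.val) + m by omega, Nat.add_mod_right,
    Nat.mod_eq_of_lt (show j.val - i.val < m by omega),
    Nat.mod_eq_of_lt (show m - j.val + i.val < m by omega)]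
  omega

/-- A walk that never turns straight back must revisit a vertex. The piece between the two visits of
its first repetition is a cycle. -/
theorem exists_isCycleSeq [Finite V] {W : Set V} (hW : W.Nonempty)
    (hdeg : ∀ v ∈ W, ∃ a ∈ W, ∃ b ∈ W, a ≠ b ∧ G.Adj v a ∧ G.Adj v b) :
    ∃ m c, IsCycleSeq G W m c := by
  classical
  have hnext : ∀ p : V × V, ∃ c, p.2 ∈ W → c ∈ W ∧ c ≠ p.1 ∧ G.Adj p.2 c := by
    rintro ⟨a, b⟩
    by_cases hb : b ∈ W
    · obtain ⟨x, hx, y, hy, hxy, hbx, hby⟩ := hdeg b hb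
      by_cases hxa : x = a
      · exact ⟨y, fun _ => ⟨hy, fun h => hxy (hxa.trans h.symm), hby⟩⟩
      · exact ⟨x, fun _ => ⟨hx, hxa, hbx⟩⟩
    · exact ⟨a, fun h => absurd h hb⟩
  choose nx hnx using hnext
  obtain ⟨w, hw⟩ := hW
  -- The pair holds the previous and the current vertex. Starting with `w` twice imposes nothing,
  -- since the next vertex is a neighbour of `w`.
  let p : ℕ → V × V := fun k => (fun q : V × V => (q.2, nx q))^[k] (w, w)
  have hp : ∀ k, p (k + 1) = ((p k).2, nx (p k)) := fun k => by
    simp only [p, Function.iterate_succ_apply']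
  have hmem : ∀ k, (p k).2 ∈ W := by
    intro k
    induction k with
    | zero => exact hw
    | succ k ih => rw [hp]; exact (hnx _ ih).1
  let c : ℕ → V := fun k => (p k).2
  have hadj : ∀ k, G.Adj (c k) (c (k + 1)) := fun k => by
    simp only [c, hp]; exact (hnx _ (hmem k)).2.2
  have hnb : ∀ k, c (k + 2) ≠ c k := fun k => by
    have h := (hnx (p (k + 1)) (hmem (k + 1))).2.1
    simp only [c, hp (k + 1)]
    rw [hp k] at h ⊢
    exact h
  have hrep : ∃ j, ∃ i < j, c i = c j := by
    obtain ⟨i, j, hij, h⟩ := Finite.exists_ne_map_eq_of_infinite c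
    rcases lt_or_gt_of_ne hij with h' | h'
    · exact ⟨j, i, h', h⟩
    · exact ⟨i, j, h', h.symm⟩
  obtain ⟨i, hij, hcij⟩ := Nat.find_spec hrep
  set j := Nat.find hrep with hj
  have hmin : ∀ a b, a < b → b < j → c a ≠ c b := fun a b hab hb h =>
    Nat.find_min hrep hb ⟨a, hab, h⟩
  refine ⟨j - i, fun k => c (i + k), ?_, fun k _ => hmem _, ?_, fun k _ => hadj _, ?_⟩
  -- Without loops and immediate returns the piece has length at least three.
  · have h1 : j ≠ i + 1 := fun h => (hadj i).ne (by rw [hcij, h])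
    have h2 : j ≠ i + 2 := fun h => hnb i (by rw [hcij, h])
    omega
  · intro a ha b hb h
    rcases lt_trichotomy a b with hab | hab | hab
    · exact absurd h (hmin _ _ (by omega) (by omega))
    · exact hab
    · exact absurd h.symm (hmin _ _ (by omega) (by omega))
  · have := hadj (j - 1)
    rw [show j - 1 + 1 = j by omega, ← hcij] at this
    simpa [show i + (j - i - 1) = j - 1 by omega] using this

/-- A chordal graph in which every vertex of `W ≠ ∅` has two neighbours in `W` has a triangle
in `W`. -/
theorem IsChordal.exists_triangle [Finite V] (hG : IsChordal G) {W : Set V} (hW : W.Nonempty)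
    (hdeg : ∀ v ∈ W, ∃ a ∈ W, ∃ b ∈ W, a ≠ b ∧ G.Adj v a ∧ G.Adj v b) :
    ∃ a ∈ W, ∃ b ∈ W, ∃ c ∈ W, G.Adj a b ∧ G.Adj b c ∧ G.Adj a c := by
  classical
  have hex : ∃ m, ∃ c, IsCycleSeq G W m c := exists_isCycleSeq hW hdeg
  obtain ⟨c, hc⟩ := Nat.find_spec hex
  set m := Nat.find hex with hm
  have hmin : ∀ k < m, ∀ c', ¬ IsCycleSeq G W k c' := fun k hk c' h =>
    Nat.find_min hex hk ⟨c', h⟩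
  have h3 := hc.three_le
  rcases h3.eq_or_lt with h | h
  · have h01 := hc.adj 0 (by omega)
    have h12 := hc.adj 1 (by omega)
    have h20 := hc.closed
    rw [← h] at h20
    exact ⟨c 0, hc.mem 0 (by omega), c 1, hc.mem 1 (by omega), c 2, hc.mem 2 (by omega),
      h01, h12, h20.symm⟩
  · exfalso
    have key : ∀ i j : Fin m, i < j →
        (G.Adj (c i) (c j) ↔ (SimpleGraph.cycleGraph m).Adj i j) := by
      intro i j hij
      have hij' : i.val < j.val := hij
      rw [cycleGraph_adj_of_lt hij]
      constructor
      · intro hadj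
        by_contra hne
        push Not at hne
        -- A chord between positions `i < j` closes the segment from `i` to `j` to a shorter cycle.
        refine hmin (j.val - i.val + 1) (by omega) (fun k => c (i.val + k)) ⟨by omega,
          fun k hk => hc.mem _ (by omega), fun a ha b hb hab => ?_, fun k hk => ?_, ?_⟩
        · have := hc.inj _ (by omega) _ (by omega) hab
          omega
        · exact hc.adj (i.val + k) (by omega)
        · simpa [show i.val + (j.val - i.val) = j.val by omega] using hadj.symm
      · rintro (h1 | ⟨h1, h2⟩)
        · rw [h1]; exact hc.adj _ (by omega)
        · rw [h1, h2]; exact hc.closed.symm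
    refine hG m h ⟨⟨⟨fun i => c i, fun i j hij => Fin.ext (hc.inj _ i.2 _ j.2 hij)⟩, ?_⟩⟩
    intro i j
    change G.Adj (c i) (c j) ↔ _
    rcases lt_trichotomy i j with hij | rfl | hij
    · exact key i j hij
    · simp
    · rw [G.adj_comm, key j i hij, SimpleGraph.adj_comm]

end Cycles

/-! ### Colourings with restrictions at the vertices -/

/-- A colour of a vertex together with a set of colours. -/
abbrev VState : Type := Fin 3 × Finset (Fin 3)

/-- Every colour, together with the empty set. -/
def freshStates : Finset VState := univ.filter fun p => p.2 = ∅

theorem mem_freshStates {p : VState} : p ∈ freshStates ↔ p.2 = ∅ := by simp [freshStates]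

/-- The states of a vertex with states `S` once a neighbour with states `M` is absorbed. -/
def absorb (S M : Finset VState) : Finset VState :=
  univ.filter fun p => ∃ q ∈ S, ∃ m ∈ M, q.1 = p.1 ∧ m.1 ≠ q.1 ∧ (m.1 < q.1 → m.1 ∉ q.2) ∧
    (q.1 < m.1 → q.1 ∉ m.2) ∧ p.2 = if m.1 < q.1 then insert m.1 q.2 else q.2

theorem mem_absorb {S M : Finset VState} {p : VState} :
    p ∈ absorb S M ↔ ∃ q ∈ S, ∃ m ∈ M, q.1 = p.1 ∧ m.1 ≠ q.1 ∧ (m.1 < q.1 → m.1 ∉ q.2) ∧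
      (q.1 < m.1 → q.1 ∉ m.2) ∧ p.2 = if m.1 < q.1 then insert m.1 q.2 else q.2 := by
  simp [absorb]

/-- Some state has colour `2` and leaves the colours `0` and `1` unused. -/
def AllowsTwo (S : Finset VState) : Prop := ∃ u, (2, u) ∈ S ∧ 0 ∉ u ∧ 1 ∉ u

instance (S : Finset VState) : Decidable (AllowsTwo S) := inferInstanceAs (Decidable (∃ _, _))

/-- Every neighbour of a vertex of colour `2` has a smaller colour, so absorbing one puts `0` or `1`
into the used set. -/
theorem not_allowsTwo_absorb (S M : Finset VState) : ¬ AllowsTwo (absorb S M) := by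
  rintro ⟨u, hu, h0, h1⟩
  obtain ⟨q, -, m, -, hq, hm, -, -, hu'⟩ := mem_absorb.1 hu
  simp only at hq hu'
  rw [hq] at hm hu'
  have : m.1 < 2 := by omega
  rw [if_pos this] at hu'
  have hmu : m.1 ∈ u := hu' ▸ mem_insert_self _ _
  have : m.1 = 0 ∨ m.1 = 1 := by omega
  rcases this with h | h <;> rw [h] at hmu <;> contradiction

section Valid

variable {V : Type*} {G : SimpleGraph V}

/-- A restricted star colouring of `G` on `W` in which each `v ∈ W` has a state from `S v`: a
colour `f v` and a set `u v` of colours that neighbours of smaller colour must avoid. -/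
structure Valid (G : SimpleGraph V) (W : Set V) (S : V → Finset VState) (f : V → Fin 3)
    (u : V → Finset (Fin 3)) : Prop where
  mem : ∀ v ∈ W, (f v, u v) ∈ S v
  proper : ∀ v ∈ W, ∀ w ∈ W, G.Adj v w → f v ≠ f w
  unused : ∀ v ∈ W, ∀ w ∈ W, G.Adj v w → f w < f v → f w ∉ u v
  once : ∀ v ∈ W, ∀ w ∈ W, ∀ z ∈ W, G.Adj v w → G.Adj v z → w ≠ z → f w = f z → ¬ f w < f v

/-- There is a valid colouring. -/
def Sat (G : SimpleGraph V) (W : Set V) (S : V → Finset VState) : Prop := ∃ f u, Valid G W S f u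

/-- An empty used set forbids nothing, so the initial tables express the original problem. -/
theorem sat_univ_iff : Sat G Set.univ (fun _ => freshStates) ↔ RSColourable G 3 := by
  constructor
  · rintro ⟨f, u, h⟩
    exact ⟨f, fun x y hxy => h.proper x trivial y trivial hxy, fun x y z hxy hyz hxz hf =>
      h.once y trivial x trivial z trivial hxy.symm hyz hxz hf⟩
  · rintro ⟨f, h⟩
    exact ⟨f, fun _ => ∅, fun v _ => mem_freshStates.2 rfl, fun v _ w _ hvw => h.proper v w hvw,
      fun v _ w _ _ _ => notMem_empty _,
      fun v _ w _ z _ hvw hvz hwz hf => h.restricted w v z hvw.symm hvz hwz hf⟩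

/-- A vertex of colour `2` has at most two neighbours. -/
theorem Valid.eq_or_eq {W : Set V} {S : V → Finset VState} {f : V → Fin 3}
    {u : V → Finset (Fin 3)} (h : Valid G W S f u) {v a b x : V} (hv : v ∈ W) (ha : a ∈ W)
    (hb : b ∈ W) (hx : x ∈ W) (hfv : f v = 2) (hva : G.Adj v a) (hvb : G.Adj v b)
    (hvx : G.Adj v x) (hab : a ≠ b) : x = a ∨ x = b := by
  have pa := h.proper v hv a ha hva
  have pb := h.proper v hv b hb hvb
  have px := h.proper v hv x hx hvx
  rw [hfv] at pa pb px
  by_contra! hne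
  have h1 := h.once v hv a ha b hb hva hvb hab
  have h2 := h.once v hv x hx a ha hvx hva hne.1
  have h3 := h.once v hv x hx b hb hvx hvb hne.2
  rw [hfv] at h1 h2 h3
  omega

/-- The two neighbours take the colours `0` and `1` once each, so neither may have been used before.
-/
theorem Valid.allowsTwo {W : Set V} {S : V → Finset VState} {f : V → Fin 3}
    {u : V → Finset (Fin 3)} (h : Valid G W S f u) {v a b : V} (hv : v ∈ W) (ha : a ∈ W)
    (hb : b ∈ W) (hfv : f v = 2) (hva : G.Adj v a) (hvb : G.Adj v b) (hab : a ≠ b) :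
    AllowsTwo (S v) := by
  have pa := h.proper v hv a ha hva
  have pb := h.proper v hv b hb hvb
  have h1 := h.once v hv a ha b hb hva hvb hab
  have ua := h.unused v hv a ha hva
  have ub := h.unused v hv b hb hvb
  have hm := h.mem v hv
  rw [hfv] at pa pb h1 ua ub hm
  refine ⟨u v, hm, ?_⟩
  have : (f a = 0 ∧ f b = 1) ∨ (f a = 1 ∧ f b = 0) := by omega
  rcases this with ⟨h0, h1⟩ | ⟨h0, h1⟩ <;> rw [h0] at ua <;> rw [h1] at ub
  · exact ⟨ua (by decide), ub (by decide)⟩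
  · exact ⟨ub (by decide), ua (by decide)⟩

open Classical in
/-- The state sets after `v` is deleted, when its neighbours absorb `M`. -/
noncomputable def removeStates (G : SimpleGraph V) (v : V) (M : Finset VState)
    (S : V → Finset VState) : V → Finset VState :=
  fun i => if G.Adj i v then absorb (S i) M else S i

/-- The colouring is kept, and each neighbour of larger colour records the colour of `v`. The
condition `once` at such a neighbour turns into `unused` for the recorded colour. -/
theorem Valid.remove {W : Set V} {S : V → Finset VState} {f : V → Fin 3}
    {u : V → Finset (Fin 3)} (h : Valid G W S f u) {v : V} (hv : v ∈ W) {M : Finset VState}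
    (hM : (f v, u v) ∈ M) : Sat G (W \ {v}) (removeStates G v M S) := by
  classical
  refine ⟨f, fun i => if G.Adj i v ∧ f v < f i then insert (f v) (u i) else u i,
    ?_, ?_, ?_, ?_⟩
  · rintro i ⟨hi, -⟩
    unfold removeStates
    by_cases hiv : G.Adj i v
    · rw [if_pos hiv, mem_absorb]
      refine ⟨_, h.mem i hi, _, hM, rfl, (h.proper i hi v hv hiv).symm, h.unused i hi v hv hiv,
        h.unused v hv i hi hiv.symm, ?_⟩
      simp [hiv]
    · simpa [hiv] using h.mem i hi
  · rintro a ⟨ha, -⟩ b ⟨hb, -⟩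
    exact h.proper a ha b hb
  · rintro a ⟨ha, -⟩ b ⟨hb, hbv⟩ hab hlt
    have h1 := h.unused a ha b hb hab hlt
    split_ifs with hc
    · rw [mem_insert, not_or]
      exact ⟨fun he => h.once a ha b hb v hv hab hc.1 hbv he hlt, h1⟩
    · exact h1
  · rintro a ⟨ha, -⟩ b ⟨hb, -⟩ c ⟨hc, -⟩
    exact h.once a ha b hb c hc

/-- A valid colouring of `W \ {v}` extends to `v` if the neighbours of `v` absorbed one common
state `m` of `v`. -/
theorem Valid.extend {W : Set V} {S S' : V → Finset VState} {f : V → Fin 3}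
    {u : V → Finset (Fin 3)} {v : V} (h : Valid G (W \ {v}) S' f u) {m : VState} (hm : m ∈ S v)
    (hS : ∀ i ∈ W, i ≠ v → ¬ G.Adj i v → S' i = S i)
    (hS' : ∀ i ∈ W, G.Adj i v → (f i, u i) ∈ absorb (S i) {m})
    (honce : ∀ i ∈ W, ∀ j ∈ W, G.Adj v i → G.Adj v j → i ≠ j → f i = f j → ¬ f i < m.1) :
    Sat G W S := by
  classical
  -- Undo the absorption: `q i` is the used set of the neighbour `i` before it met `m`.
  have hq : ∀ i, ∃ q : Finset (Fin 3), i ∈ W → G.Adj i v → (f i, q) ∈ S i ∧ m.1 ≠ f i ∧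
      (m.1 < f i → m.1 ∉ q) ∧ (f i < m.1 → f i ∉ m.2) ∧
      u i = if m.1 < f i then insert m.1 q else q := by
    intro i
    by_cases hi : i ∈ W ∧ G.Adj i v
    · obtain ⟨q, hq, m', hm', h1, h2, h3, h4, h5⟩ := mem_absorb.1 (hS' i hi.1 hi.2)
      rw [mem_singleton] at hm'
      subst hm'
      simp only at h1 h5
      rw [h1] at h2 h3 h4 h5
      exact ⟨q.2, fun _ _ => ⟨by rw [← h1]; exact hq, h2, h3, h4, h5⟩⟩
    · exact ⟨∅, fun h1 h2 => absurd ⟨h1, h2⟩ hi⟩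
  choose q hq using hq
  have hvi : ∀ i, G.Adj i v → i ≠ v := fun i hi => hi.ne
  refine ⟨Function.update f v m.1,
    Function.update (fun i => if G.Adj i v then q i else u i) v m.2, ?_, ?_, ?_, ?_⟩
  · intro i hi
    by_cases hiv : i = v
    · subst hiv; simpa using hm
    · simp only [Function.update_of_ne hiv]
      split_ifs with hadj
      · exact (hq i hi hadj).1
      · rw [← hS i hi hiv hadj]; exact h.mem i ⟨hi, hiv⟩
  · intro a ha b hb hab
    by_cases hav : a = v
    · subst hav
      rw [Function.update_self, Function.update_of_ne hab.ne.symm]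
      exact (hq b hb hab.symm).2.1
    · by_cases hbv : b = v
      · subst hbv
        rw [Function.update_self, Function.update_of_ne hav]
        exact (hq a ha hab).2.1.symm
      · rw [Function.update_of_ne hav, Function.update_of_ne hbv]
        exact h.proper a ⟨ha, hav⟩ b ⟨hb, hbv⟩ hab
  · intro a ha b hb hab
    by_cases hav : a = v
    · subst hav
      simp only [Function.update_self, Function.update_of_ne hab.ne.symm]
      exact (hq b hb hab.symm).2.2.2.1
    · by_cases hbv : b = v
      · subst hbv
        simp only [Function.update_self, Function.update_of_ne hav, if_pos hab]
        exact (hq a ha hab).2.2.1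
      · simp only [Function.update_of_ne hav, Function.update_of_ne hbv]
        intro hlt
        have h1 := h.unused a ⟨ha, hav⟩ b ⟨hb, hbv⟩ hab hlt
        split_ifs with hadj
        · rw [(hq a ha hadj).2.2.2.2] at h1
          split_ifs at h1
          · exact fun h2 => h1 (mem_insert_of_mem h2)
          · exact h1
        · exact h1
  · intro a ha b hb c hc hab hac hbc
    by_cases hav : a = v
    · subst hav
      simp only [Function.update_self, Function.update_of_ne hab.ne.symm,
        Function.update_of_ne hac.ne.symm]
      exact honce b hb c hc hab hac hbc
    -- A remaining neighbour `x` of `a` cannot repeat the colour of `v` when it is below that of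
    -- `a`, because absorption entered this colour in `u a`.
    · have main : ∀ x ∈ W, x ≠ v → G.Adj a x → G.Adj a v → m.1 < f a → f x = m.1 → False := by
        intro x hx hxv hax hadj hlt he
        have h1 := h.unused a ⟨ha, hav⟩ x ⟨hx, hxv⟩ hax (he ▸ hlt)
        rw [(hq a ha hadj).2.2.2.2, if_pos hlt, he] at h1
        exact h1 (mem_insert_self _ _)
      by_cases hbv : b = v
      · subst hbv
        simp only [Function.update_self, Function.update_of_ne hav,
          Function.update_of_ne hbc.symm]
        exact fun he hlt => main c hc hbc.symm hac hab hlt he.symm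
      · by_cases hcv : c = v
        · subst hcv
          simp only [Function.update_self, Function.update_of_ne hav, Function.update_of_ne hbc]
          exact fun he hlt => main b hb hbc hab hac (he ▸ hlt) he
        · simp only [Function.update_of_ne hav, Function.update_of_ne hbv,
            Function.update_of_ne hcv]
          exact h.once a ⟨ha, hav⟩ b ⟨hb, hbv⟩ c ⟨hc, hcv⟩ hab hac hbc

/-- Deleting a vertex with at most one neighbour. -/
theorem sat_remove_leaf_iff {W : Set V} {S : V → Finset VState} {v : V} (hv : v ∈ W)
    (hne : (S v).Nonempty)
    (hdeg : ∀ a ∈ W, ∀ b ∈ W, G.Adj v a → G.Adj v b → a = b) :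
    Sat G W S ↔ Sat G (W \ {v}) (removeStates G v (S v) S) := by
  classical
  constructor
  · rintro ⟨f, u, h⟩
    exact h.remove hv (h.mem v hv)
  · rintro ⟨f, u, h⟩
    have hS : ∀ i ∈ W, i ≠ v → ¬ G.Adj i v → removeStates G v (S v) S i = S i :=
      fun i _ _ hi => by simp [removeStates, hi]
    have ho : ∀ m : VState, ∀ i ∈ W, ∀ j ∈ W, G.Adj v i → G.Adj v j → i ≠ j → f i = f j →
        ¬ f i < m.1 := fun m i hi j hj hvi hvj hij => absurd (hdeg i hi j hj hvi hvj) hij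
    by_cases ha : ∃ a ∈ W, G.Adj a v
    · obtain ⟨a, ha, hav⟩ := ha
      have hm := h.mem a ⟨ha, hav.ne⟩
      rw [removeStates, if_pos hav] at hm
      -- The state of the only neighbour reveals a state `m` of `v` that it absorbed.
      obtain ⟨q, hq, m, hm, h1⟩ := mem_absorb.1 hm
      refine h.extend hm hS (fun i hi hiv => ?_) (ho m)
      rw [hdeg i hi a ha hiv.symm hav.symm]
      exact mem_absorb.2 ⟨q, hq, m, mem_singleton_self m, h1⟩
    -- An isolated vertex takes any state; only here must the table be nonempty.
    · obtain ⟨m, hm⟩ := hne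
      exact h.extend hm hS (fun i hi hiv => absurd ⟨i, hi, hiv⟩ ha) (ho m)

/-- If `v` and `a` are twins that are not restricted, their states may be exchanged. -/
theorem Valid.swap [DecidableEq V] {W : Set V} {S : V → Finset VState} {f : V → Fin 3}
    {u : V → Finset (Fin 3)} (h : Valid G W S f u) {v a : V} (hv : v ∈ W) (ha : a ∈ W)
    (htwin : ∀ x ∈ W, x ≠ v → x ≠ a → (G.Adj x v ↔ G.Adj x a))
    (hSv : S v = S a) :
    Valid G W S (f ∘ Equiv.swap v a) (u ∘ Equiv.swap v a) := by
  have hW : ∀ x ∈ W, Equiv.swap v a x ∈ W := by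
    intro x hx
    rw [Equiv.swap_apply_def]
    split_ifs <;> assumption
  have hadj : ∀ x ∈ W, ∀ y ∈ W, G.Adj x y → G.Adj (Equiv.swap v a x) (Equiv.swap v a y) := by
    intro x hx y hy hxy
    simp only [Equiv.swap_apply_def]
    split_ifs with h1 h2 h3 h4 h5 h6 h7 h8
    · rw [h1, h2] at hxy; exact absurd hxy G.irrefl
    · rw [h1, h3] at hxy; exact hxy.symm
    · rw [h1] at hxy; exact ((htwin y hy h2 h3).1 hxy.symm).symm
    · rw [h4, h5] at hxy; exact hxy.symm
    · rw [h4, h6] at hxy; exact absurd hxy G.irrefl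
    · rw [h4] at hxy; exact ((htwin y hy h5 h6).2 hxy.symm).symm
    · rw [h7] at hxy; exact (htwin x hx h1 h4).1 hxy
    · rw [h8] at hxy; exact (htwin x hx h1 h4).2 hxy
    · exact hxy
  refine ⟨?_, ?_, ?_, ?_⟩
  · intro x hx
    have h1 := h.mem _ (hW x hx)
    have : S (Equiv.swap v a x) = S x := by
      rw [Equiv.swap_apply_def]; split_ifs with h2 h3
      · rw [h2, hSv]
      · rw [h3, hSv]
      · rfl
    rwa [this] at h1
  · intro x hx y hy hxy
    exact h.proper _ (hW x hx) _ (hW y hy) (hadj x hx y hy hxy)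
  · intro x hx y hy hxy
    exact h.unused _ (hW x hx) _ (hW y hy) (hadj x hx y hy hxy)
  · intro x hx y hy z hz hxy hxz hyz
    exact h.once _ (hW x hx) _ (hW y hy) _ (hW z hz) (hadj x hx y hy hxy) (hadj x hx z hz hxz)
      ((Equiv.swap v a).injective.ne hyz)

/-- Deleting a vertex of degree two in a triangle: it may be assumed to have colour `2`. -/
theorem sat_remove_ear_iff {W : Set V} {S : V → Finset VState} {v a b : V} (hv : v ∈ W)
    (ha : a ∈ W) (hb : b ∈ W) (hva : G.Adj v a) (hvb : G.Adj v b) (hab : G.Adj a b)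
    (hdeg : ∀ x ∈ W, G.Adj v x → x = a ∨ x = b)
    (hS : ∀ x ∈ W, AllowsTwo (S x) → S x = freshStates) (htwo : AllowsTwo (S v)) :
    Sat G W S ↔ Sat G (W \ {v}) (removeStates G v {(2, ∅)} S) := by
  classical
  have hSv := hS v hv htwo
  constructor
  · rintro ⟨f, u, h⟩
    suffices h' : ∃ f u, Valid G W S f u ∧ f v = 2 by
      obtain ⟨f, u, h, hf⟩ := h'
      have hu := h.mem v hv
      rw [hSv, mem_freshStates] at hu
      exact h.remove hv (mem_singleton.2 (Prod.ext hf hu))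
    -- If `a` has colour `2`, its only neighbours are `v` and `b`. So `v` and `a` are twins with
    -- equal tables and can be exchanged.
    have key : ∀ a ∈ W, ∀ b ∈ W, G.Adj v a → G.Adj v b → G.Adj a b →
        (∀ x ∈ W, G.Adj v x → x = a ∨ x = b) → f a = 2 → ∃ f u, Valid G W S f u ∧ f v = 2 := by
      intro a ha b hb hva hvb hab hdeg hfa
      have hSa := hS a ha (h.allowsTwo ha hv hb hfa hva.symm hab hvb.ne)
      refine ⟨_, _, h.swap hv ha (fun x hx hxv hxa => ⟨fun hx' => ?_, fun hx' => ?_⟩)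
        (hSv.trans hSa.symm), by simpa using hfa⟩
      · rcases hdeg x hx hx'.symm with rfl | rfl
        · exact absurd rfl hxa
        · exact hab.symm
      · rcases h.eq_or_eq ha hv hb hx hfa hva.symm hab hx'.symm hvb.ne with rfl | rfl
        · exact absurd rfl hxv
        · exact hvb.symm
    have h1 := h.proper v hv a ha hva
    have h2 := h.proper v hv b hb hvb
    have h3 := h.proper a ha b hb hab
    have : f v = 2 ∨ f a = 2 ∨ f b = 2 := by omega
    rcases this with h4 | h4 | h4
    · exact ⟨f, u, h, h4⟩
    · exact key a ha b hb hva hvb hab hdeg h4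
    · exact key b hb a ha hvb hva hab.symm (fun x hx hvx => (hdeg x hx hvx).symm) h4
  · rintro ⟨f, u, h⟩
    refine h.extend (m := (2, ∅)) (hSv ▸ mem_freshStates.2 rfl)
      (fun i _ _ hi => by simp [removeStates, hi]) (fun i hi hiv => ?_) ?_
    · have := h.mem i ⟨hi, hiv.ne⟩
      rwa [removeStates, if_pos hiv] at this
    -- The two neighbours of `v` are adjacent, so their colours differ and colour `2` is allowed at
    -- `v`.
    · have hne := h.proper a ⟨ha, hva.ne.symm⟩ b ⟨hb, hvb.ne.symm⟩ hab
      intro i hi j hj hvi hvj hij hf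
      rcases hdeg i hi hvi with rfl | rfl <;> rcases hdeg j hj hvj with rfl | rfl
      · exact absurd rfl hij
      · exact absurd hf hne
      · exact absurd hf.symm hne
      · exact absurd rfl hij

/-- A satisfiable instance on a chordal graph has a vertex with at most one neighbour or a vertex
that allows colour `2` and has exactly two neighbours, which are adjacent. -/
theorem Sat.exists_leaf_or_ear [Finite V] (hG : IsChordal G) {W : Set V} (hW : W.Nonempty)
    {S : V → Finset VState} (hsat : Sat G W S) :
    (∃ v ∈ W, ∀ a ∈ W, ∀ b ∈ W, G.Adj v a → G.Adj v b → a = b) ∨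
    ∃ v ∈ W, AllowsTwo (S v) ∧ ∃ a ∈ W, ∃ b ∈ W, a ≠ b ∧ G.Adj v a ∧ G.Adj v b ∧ G.Adj a b ∧
      ∀ x ∈ W, G.Adj v x → x = a ∨ x = b := by
  by_contra! hcon
  obtain ⟨h1, h2⟩ := hcon
  obtain ⟨f, u, h⟩ := hsat
  obtain ⟨a, ha, b, hb, c, hc, hab, hbc, hac⟩ := hG.exists_triangle hW (fun v hv => by
    obtain ⟨a, ha, b, hb, hva, hvb, hne⟩ := h1 v hv
    exact ⟨a, ha, b, hb, hne, hva, hvb⟩)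
  -- A vertex of colour `2` in a triangle would be an ear. Without ears only two colours are left
  -- for the triangle.
  have key : ∀ v ∈ W, ∀ a ∈ W, ∀ b ∈ W, G.Adj v a → G.Adj v b → G.Adj a b → f v ≠ 2 := by
    intro v hv a ha b hb hva hvb hab hfv
    obtain ⟨x, hx, hvx, hxa, hxb⟩ := h2 v hv (h.allowsTwo hv ha hb hfv hva hvb hab.ne)
      a ha b hb hab.ne hva hvb hab
    rcases h.eq_or_eq hv ha hb hx hfv hva hvb hvx hab.ne with h3 | h3
    · exact hxa h3
    · exact hxb h3
  have h3 := key a ha b hb c hc hab hac hbc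
  have h4 := key b hb a ha c hc hab.symm hbc hac
  have h5 := key c hc a ha b hb hac.symm hbc.symm hab
  have h6 := h.proper a ha b hb hab
  have h7 := h.proper b hb c hc hbc
  have h8 := h.proper a ha c hc hac
  omega

end Valid


open Turing TM2.Stmt

/-! ### The machine -/

/-- The status of a vertex: `none` if it has been deleted, and otherwise its set of states,
together with a mark on vertices that are known not to lie in a triangle. -/
abbrev Status : Type := Option (Bool × Finset VState)

/-- The stacks of the machine. -/
inductive Stack
  | inp | x | y | r | q | out
  deriving DecidableEq

instance : Fintype Stack := ⟨{.inp, .x, .y, .r, .q, .out}, fun k => by cases k <;> decide⟩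

/-- The letters on the work stacks: an entry of the matrix, where `none` stands for the diagonal,
or the end of a row, carrying the status of its vertex. -/
inductive Cell
  | ent (e : Option Bool)
  | rowEnd (s : Status)
  deriving Fintype

/-- What to do with the selected vertex: look for a triangle, or delete it with a message to its
neighbours (`some M`), or mark it (`none`). -/
inductive Mode
  | chk (found : Bool)
  | upd (M : Option (Finset VState))
  deriving Fintype

/-- The labels of the program. -/
inductive Label
  | read (d : Bool)
  | back
  | clear
  | rew (m : Option Mode)
  | sel (d : Fin 4) (alive : Bool)
  | copy (m : Mode)
  | pass (m : Mode) (nb adj self : Bool)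
  | unw (m : Mode)
  | fin (ans : Bool)
  deriving Fintype

/-- The alphabets of the stacks. -/
abbrev Alphabet : Stack → Type
  | .inp => Option Bool
  | .out => Bool
  | _ => Cell

/-- Two registers for letters. -/
abbrev Register : Type := Option Cell × Option Cell

/-- The letter for a letter of the input. -/
def Cell.ofInput : Option Bool → Cell
  | some b => .ent (some b)
  | none => .rowEnd (some (false, freshStates))

def Cell.isEnt : Option Cell → Bool
  | some (.ent _) => true
  | _ => false

def Cell.entry : Option Cell → Option Bool
  | some (.ent e) => e
  | _ => none

def Cell.status : Option Cell → Status
  | some (.rowEnd s) => s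
  | _ => none

/-- Counting up to three. -/
def cap (k : ℕ) : Fin 4 := ⟨min 3 k, by omega⟩

/-- The number of neighbours, after one more entry of the row. -/
def bump (e : Option Bool) (d : Fin 4) : Fin 4 := if e = some true then cap (d + 1) else d

/-- A vertex is selected if it has at most one neighbour, or has two, allows the colour `2` and
is not marked. -/
def selectable (s : Status) (d : Fin 4) : Bool :=
  s.elim false fun t => decide (t.2.Nonempty ∧ (d ≤ 1 ∨ (d = 2 ∧ AllowsTwo t.2 ∧ t.1 = false)))

/-- How to treat a selected vertex. -/
def modeOf (s : Status) (d : Fin 4) : Mode :=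
  if d ≤ 1 then .upd (some (s.elim ∅ Prod.snd)) else .chk false

/-- The new entry of the matrix, where `ρ` is the entry of the selected row in its column. -/
def newEntry (m : Mode) (e ρ : Option Bool) : Option Bool :=
  match m with
  | .upd (some _) => if ρ = none ∧ e ≠ none then some false else e
  | _ => e

/-- The new status of a vertex, where `nb` says if it is a neighbour of the selected vertex and
`self` if it is the selected vertex. -/
def newStatus (m : Mode) (nb self : Bool) (s : Status) : Status :=
  match m with
  | .chk _ => s
  | .upd (some M) => if self then none else if nb then s.map fun t => (t.1, absorb t.2 M) else s
  | .upd none => if self then s.map fun t => (true, t.2) else s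

/-- The mode after a row, where `adj` says if the vertex has a common neighbour with the selected
vertex. -/
def newMode (m : Mode) (nb adj : Bool) (s : Status) : Mode :=
  match m with
  | .chk found => .chk (found || (nb && adj && s.isSome))
  | .upd M => .upd M

/-- The label after a pass. -/
def afterPass : Mode → Label
  | .chk found => .rew (some (.upd (if found then some {(2, ∅)} else none)))
  | .upd _ => .clear

/-- The label after the rewinding. -/
def afterRew : Option Mode → Label
  | none => .sel 0 false
  | some m => .pass m false false false

/-- Distinguish whether the first register holds nothing, an entry, or the end of a row. -/
def onCell (qn qe qs : TM2.Stmt Alphabet Label Register) : TM2.Stmt Alphabet Label Register :=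
  branch (fun v => v.1.isNone) qn (branch (fun v => Cell.isEnt v.1) qe qs)

/-- The content of the first register. -/
def fst (v : Register) : Cell := v.1.getD (.ent none)

/-- The content of the second register. -/
def snd (v : Register) : Cell := v.2.getD (.ent none)

/-- The program: `read` copies the matrix to `y` and marks its diagonal, with `r` as a counter;
`rew` moves `y` back to `x`; `sel` looks for a vertex to delete; `copy` copies its row to `r`;
`pass` compares all rows with that row. -/
def program : Label → TM2.Stmt Alphabet Label Register
  | .read d =>
    pop .inp (fun _ (a : Option (Option Bool)) => (a.map Cell.ofInput, none)) <|
    onCell (goto fun _ => .clear)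
      (match d with
        | true => push .y fst <| goto fun _ => .read true
        -- The counter `r` holds one letter for each row already read, so it runs out exactly at the
        -- diagonal entry.
        | false => pop .r (fun v c => (v.1, c)) <|
          branch (fun v => v.2.isNone)
            (push .y (fun _ => .ent none) <| goto fun _ => .read true)
            (push .q snd <| push .y fst <| goto fun _ => .read false))
      (push .y fst <| goto fun _ => .back)
  | .back =>
    pop .q (fun _ c => (c, none)) <|
    branch (fun v => v.1.isNone) (push .r (fun _ => .ent none) <| goto fun _ => .read false)
      (push .r fst <| goto fun _ => .back)
  | .clear =>
    pop .r (fun _ c => (c, none)) <|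
    branch (fun v => v.1.isNone) (goto fun _ => .rew none) (goto fun _ => .clear)
  | .rew m =>
    pop .y (fun _ c => (c, none)) <|
    branch (fun v => v.1.isNone) (goto fun _ => afterRew m) (push .x fst <| goto fun _ => .rew m)
  | .sel d alive =>
    pop .x (fun _ c => (c, none)) <|
    onCell (goto fun _ => .fin !alive)
      (push .y fst <| goto fun v => .sel (bump (Cell.entry v.1) d) alive)
      (branch (fun v => selectable (Cell.status v.1) d)
        (push .x fst <| goto fun v => .copy (modeOf (Cell.status v.1) d))
        (push .y fst <| goto fun v => .sel 0 (alive || (Cell.status v.1).isSome)))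
  | .copy m =>
    pop .y (fun _ c => (c, none)) <|
    onCell (goto fun _ => .rew (some m))
      (push .x fst <| push .r fst <| goto fun _ => .copy m)
      (push .y fst <| goto fun _ => .rew (some m))
  | .pass m nb adj self =>
    pop .x (fun _ c => (c, none)) <|
    onCell (goto fun _ => afterPass m)
      (pop .r (fun v c => (v.1, c)) <| push .q snd <|
        push .y (fun v => .ent (newEntry m (Cell.entry v.1) (Cell.entry v.2))) <|
        goto fun v => .pass m
          -- In the copied row the diagonal letter `none` marks the column of the selected vertex. A
          -- row with `none` in the same column is the selected row itself.
          (nb || (Cell.entry v.2 == none && Cell.entry v.1 == some true))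
          (adj || (Cell.entry v.2 == some true && Cell.entry v.1 == some true))
          (self || (Cell.entry v.2 == none && Cell.entry v.1 == none)))
      (push .y (fun v => .rowEnd (newStatus m nb self (Cell.status v.1))) <|
        goto fun v => .unw (newMode m nb adj (Cell.status v.1)))
  | .unw m =>
    pop .q (fun _ c => (c, none)) <|
    branch (fun v => v.1.isNone) (goto fun _ => .pass m false false false)
      (push .r fst <| goto fun _ => .unw m)
  | .fin ans =>
    pop .y (fun _ c => (c, none)) <|
    branch (fun v => v.1.isNone)
      -- The prescribed halting configuration has empty work stacks and the initial registers.
      (push .out (fun _ => ans) <| load (fun _ => (none, none)) <| halt)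
      (goto fun _ => .fin ans)

/-- The machine. -/
def machine : FinTM2 where
  K := Stack
  k₀ := .inp
  k₁ := .out
  Γ := Alphabet
  Λ := Label
  main := .read false
  σ := Register
  initialState := (none, none)
  σFin := inferInstanceAs (Fintype (Option Cell × Option Cell))
  Γk₀Fin := inferInstanceAs (Fintype (Option Bool))
  m := program

/-- The stacks with the given contents. -/
def stk (inp : List (Option Bool)) (x y r q : List Cell) (out : List Bool := []) :
    ∀ k, List (Alphabet k)
  | .inp => inp
  | .x => x
  | .y => y
  | .r => r
  | .q => q
  | .out => out

section

variable (inp : List (Option Bool)) (x y r q : List Cell) (out : List Bool)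

@[simp] theorem stk_inp : stk inp x y r q out .inp = inp := rfl
@[simp] theorem stk_x : stk inp x y r q out .x = x := rfl
@[simp] theorem stk_y : stk inp x y r q out .y = y := rfl
@[simp] theorem stk_r : stk inp x y r q out .r = r := rfl
@[simp] theorem stk_q : stk inp x y r q out .q = q := rfl
@[simp] theorem stk_out : stk inp x y r q out .out = out := rfl

@[simp] theorem update_inp (l : List (Option Bool)) :
    Function.update (stk inp x y r q out) .inp l = stk l x y r q out := by
  funext k; cases k <;> rfl
@[simp] theorem update_x (l : List Cell) :
    Function.update (stk inp x y r q out) .x l = stk inp l y r q out := by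
  funext k; cases k <;> rfl
@[simp] theorem update_y (l : List Cell) :
    Function.update (stk inp x y r q out) .y l = stk inp x l r q out := by
  funext k; cases k <;> rfl
@[simp] theorem update_r (l : List Cell) :
    Function.update (stk inp x y r q out) .r l = stk inp x y l q out := by
  funext k; cases k <;> rfl
@[simp] theorem update_q (l : List Cell) :
    Function.update (stk inp x y r q out) .q l = stk inp x y r l out := by
  funext k; cases k <;> rfl
@[simp] theorem update_out (l : List Bool) :
    Function.update (stk inp x y r q out) .out l = stk inp x y r q l := by
  funext k; cases k <;> rfl

end

/-- From label `l` and stacks `S` the program comes within `t` steps to label `l'` and stacks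
`S'`. -/
def Run (t : ℕ) (l : Label) (S : ∀ k, List (Alphabet k)) (l' : Label)
    (S' : ∀ k, List (Alphabet k)) : Prop :=
  ∀ v, ∃ v', ∃ j ≤ t, (flip bind (TM2.step program))^[j] (some ⟨some l, v, S⟩) =
    some ⟨some l', v', S'⟩

theorem Run.refl (t : ℕ) (l : Label) (S : ∀ k, List (Alphabet k)) : Run t l S l S :=
  fun v => ⟨v, 0, by omega, rfl⟩

theorem Run.trans {t t' : ℕ} {l l' l'' : Label} {S S' S'' : ∀ k, List (Alphabet k)}
    (h : Run t l S l' S') (h' : Run t' l' S' l'' S'') : Run (t + t') l S l'' S'' := by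
  intro v
  obtain ⟨v', j, hj, e⟩ := h v
  obtain ⟨v'', j', hj', e'⟩ := h' v'
  exact ⟨v'', j' + j, by omega, by rw [Function.iterate_add_apply, e, e']⟩

theorem Run.mono {t t' : ℕ} {l l' : Label} {S S' : ∀ k, List (Alphabet k)}
    (h : Run t l S l' S') (ht : t ≤ t') : Run t' l S l' S' := fun v =>
  let ⟨v', j, hj, e⟩ := h v
  ⟨v', j, hj.trans ht, e⟩

theorem Run.step {l l' : Label} {S S' : ∀ k, List (Alphabet k)}
    (h : ∀ v, ∃ v', TM2.stepAux (program l) v S = ⟨some l', v', S'⟩) : Run 1 l S l' S' := fun v =>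
  let ⟨v', e⟩ := h v
  ⟨v', 1, le_rfl, congrArg some e⟩

/-! ### Single transitions and simple stack loops -/

section Steps

variable (inp : List (Option Bool)) (x y r q : List Cell)

theorem run_read_nil (d : Bool) :
    Run 1 (.read d) (stk [] x y r q) .clear (stk [] x y r q) :=
  .step fun v => ⟨_, by simp [program, onCell]; rfl⟩

theorem run_read_stop (d : Bool) : Run 1 (.read d) (stk (none :: inp) x y r q) .back
    (stk inp x (.rowEnd (some (false, freshStates)) :: y) r q) :=
  .step fun v => ⟨_, by simp [program, onCell, fst, Cell.ofInput, Cell.isEnt]; rfl⟩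

theorem run_read_true (b : Bool) : Run 1 (.read true) (stk (some b :: inp) x y r q) (.read true)
    (stk inp x (.ent (some b) :: y) r q) :=
  .step fun v => ⟨_, by simp [program, onCell, fst, Cell.ofInput, Cell.isEnt]; rfl⟩

theorem run_read_false (b : Bool) (c : Cell) :
    Run 1 (.read false) (stk (some b :: inp) x y (c :: r) q) (.read false)
      (stk inp x (.ent (some b) :: y) r (c :: q)) :=
  .step fun v => ⟨_, by simp [program, onCell, fst, snd, Cell.ofInput, Cell.isEnt]; rfl⟩

theorem run_read_diag (b : Bool) :
    Run 1 (.read false) (stk (some b :: inp) x y [] q) (.read true)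
      (stk inp x (.ent none :: y) [] q) :=
  .step fun v => ⟨_, by simp [program, onCell, Cell.ofInput, Cell.isEnt]; rfl⟩

/-- The additional letter advances the counter to the next row. -/
theorem run_back : Run (q.length + 1) .back (stk inp x y r q) (.read false)
    (stk inp x y (.ent none :: (q.reverse ++ r)) []) := by
  induction q generalizing r with
  | nil => exact .step fun v => ⟨_, by simp [program]; rfl⟩
  | cons c q ih =>
    have h : Run 1 .back (stk inp x y r (c :: q)) .back (stk inp x y (c :: r) q) :=
      .step fun v => ⟨_, by simp [program, fst]; rfl⟩
    rw [List.reverse_cons, List.append_assoc]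
    exact (h.trans (ih (c :: r))).mono (by simp only [List.length_cons]; omega)

theorem run_unw (m : Mode) : Run (q.length + 1) (.unw m) (stk inp x y r q)
    (.pass m false false false) (stk inp x y (q.reverse ++ r) []) := by
  induction q generalizing r with
  | nil => exact .step fun v => ⟨_, by simp [program]; rfl⟩
  | cons c q ih =>
    have h : Run 1 (.unw m) (stk inp x y r (c :: q)) (.unw m) (stk inp x y (c :: r) q) :=
      .step fun v => ⟨_, by simp [program, fst]; rfl⟩
    rw [List.reverse_cons, List.append_assoc]
    exact (h.trans (ih (c :: r))).mono (by simp only [List.length_cons]; omega)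

theorem run_clear : Run (r.length + 1) .clear (stk inp x y r q) (.rew none)
    (stk inp x y [] q) := by
  induction r with
  | nil => exact .step fun v => ⟨_, by simp [program]; rfl⟩
  | cons c r ih =>
    have h : Run 1 .clear (stk inp x y (c :: r) q) .clear (stk inp x y r q) :=
      .step fun v => ⟨_, by simp [program]; rfl⟩
    exact (h.trans ih).mono (by simp; omega)

theorem run_rew (m : Option Mode) : Run (y.length + 1) (.rew m) (stk inp x y r q)
    (afterRew m) (stk inp (y.reverse ++ x) [] r q) := by
  induction y generalizing x with
  | nil => exact .step fun v => ⟨_, by simp [program]; rfl⟩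
  | cons c y ih =>
    have h : Run 1 (.rew m) (stk inp x (c :: y) r q) (.rew m) (stk inp (c :: x) y r q) :=
      .step fun v => ⟨_, by simp [program, fst]; rfl⟩
    rw [List.reverse_cons, List.append_assoc]
    exact (h.trans (ih (c :: x))).mono (by simp only [List.length_cons]; omega)

/-- `Run` does not apply here, because the halting configuration has no label. -/
theorem run_fin (ans : Bool) (v : Register) :
    ∃ j ≤ y.length + 1, (flip bind (TM2.step program))^[j]
      (some ⟨some (.fin ans), v, stk inp x y r q⟩) =
      some ⟨none, (none, none), stk inp x [] r q [ans]⟩ := by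
  induction y generalizing v with
  | nil => exact ⟨1, by simp, by simp [flip, program]⟩
  | cons c y ih =>
    obtain ⟨j, hj, e⟩ := ih (some c, none)
    refine ⟨j + 1, by simp; omega, ?_⟩
    rw [Function.iterate_succ_apply, ← e]
    simp [flip, program]

end Steps


/-! ### Matrices as words on a stack -/

section Encoding

variable {ι : Type*}

/-- The letters of a row with the given entries. -/
def cells (js : List ι) (e : ι → Option Bool) : List Cell := js.map fun j => .ent (e j)

/-- The rows `is` of a matrix with columns `js`, each followed by the status of its vertex. -/
def rows (js is : List ι) (e : ι → ι → Option Bool) (s : ι → Status) : List Cell :=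
  is.flatMap fun i => cells js (e i) ++ [.rowEnd (s i)]

@[simp] theorem cells_nil (e : ι → Option Bool) : cells [] e = [] := rfl

@[simp] theorem cells_cons (j : ι) (js : List ι) (e : ι → Option Bool) :
    cells (j :: js) e = .ent (e j) :: cells js e := rfl

@[simp] theorem length_cells (js : List ι) (e : ι → Option Bool) :
    (cells js e).length = js.length := List.length_map _

@[simp] theorem rows_nil (js : List ι) (e : ι → ι → Option Bool) (s : ι → Status) :
    rows js [] e s = [] := rfl

theorem rows_cons (js is : List ι) (i : ι) (e : ι → ι → Option Bool) (s : ι → Status) :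
    rows js (i :: is) e s = cells js (e i) ++ .rowEnd (s i) :: rows js is e s := by
  simp [rows]

theorem length_rows (js is : List ι) (e : ι → ι → Option Bool) (s : ι → Status) :
    (rows js is e s).length = is.length * (js.length + 1) := by
  induction is with
  | nil => simp
  | cons i is ih => rw [rows_cons]; simp [ih]; ring

end Encoding

/-! ### Passes over the matrix and the cost of a round -/

section Loops

variable {ι : Type*} (x y r q : List Cell)

/-- The entry of a vertex `i` for the selected vertex is a one. -/
def hasNb (js : List ι) (e ρ : ι → Option Bool) : Bool :=
  js.any fun j => ρ j == none && e j == some true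

/-- Two rows have a common one. -/
def hasCommon (js : List ι) (e ρ : ι → Option Bool) : Bool :=
  js.any fun j => ρ j == some true && e j == some true

/-- The diagonal entries of two rows are at the same place. -/
def isSelf (js : List ι) (e ρ : ι → Option Bool) : Bool :=
  js.any fun j => ρ j == none && e j == none

theorem run_pass_entries (m : Mode) (nb adj self : Bool) (js : List ι) (e ρ : ι → Option Bool) :
    Run js.length (.pass m nb adj self) (stk [] (cells js e ++ x) y (cells js ρ ++ r) q)
      (.pass m (nb || hasNb js e ρ) (adj || hasCommon js e ρ) (self || isSelf js e ρ))
      (stk [] x ((cells js fun j => newEntry m (e j) (ρ j)).reverse ++ y) r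
        ((cells js ρ).reverse ++ q)) := by
  induction js generalizing nb adj self y q with
  | nil => simpa [hasNb, hasCommon, isSelf] using Run.refl _ _ _
  | cons j js ih =>
    have h : Run 1 (.pass m nb adj self)
        (stk [] (.ent (e j) :: (cells js e ++ x)) y (.ent (ρ j) :: (cells js ρ ++ r)) q)
        (.pass m (nb || (ρ j == none && e j == some true))
          (adj || (ρ j == some true && e j == some true)) (self || (ρ j == none && e j == none)))
        (stk [] (cells js e ++ x) (.ent (newEntry m (e j) (ρ j)) :: y) (cells js ρ ++ r)
          (.ent (ρ j) :: q)) :=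
      .step fun v => ⟨_, by simp [program, onCell, snd, Cell.isEnt, Cell.entry]; rfl⟩
    have h' := h.trans (ih _ _ _ _ _)
    simp only [Bool.or_assoc] at h'
    simp only [cells_cons, List.reverse_cons, List.append_assoc, List.cons_append,
      List.nil_append, hasNb, hasCommon, isSelf, List.any_cons]
    exact h'.mono (by simp only [List.length_cons]; omega)

/-- One step for each entry, one for the row end, and `js.length + 1` to move the copied row back to
`r` for the next row. -/
theorem run_pass_row (m : Mode) (js : List ι) (e ρ : ι → Option Bool) (s : Status) :
    Run (2 * js.length + 2) (.pass m false false false)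
      (stk [] (cells js e ++ .rowEnd s :: x) y (cells js ρ) [])
      (.pass (newMode m (hasNb js e ρ) (hasCommon js e ρ) s) false false false)
      (stk [] x (.rowEnd (newStatus m (hasNb js e ρ) (isSelf js e ρ) s) ::
        ((cells js fun j => newEntry m (e j) (ρ j)).reverse ++ y)) (cells js ρ) []) := by
  have h1 := run_pass_entries (.rowEnd s :: x) y [] [] m false false false js e ρ
  simp only [Bool.false_or, List.append_nil] at h1
  have h2 : Run 1 (.pass m (hasNb js e ρ) (hasCommon js e ρ) (isSelf js e ρ))
      (stk [] (.rowEnd s :: x) ((cells js fun j => newEntry m (e j) (ρ j)).reverse ++ y) []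
        (cells js ρ).reverse) (.unw (newMode m (hasNb js e ρ) (hasCommon js e ρ) s))
      (stk [] x (.rowEnd (newStatus m (hasNb js e ρ) (isSelf js e ρ) s) ::
        ((cells js fun j => newEntry m (e j) (ρ j)).reverse ++ y)) [] (cells js ρ).reverse) :=
    .step fun v => ⟨_, by simp [program, onCell, Cell.isEnt, Cell.status]; rfl⟩
  have h3 := run_unw [] x (.rowEnd (newStatus m (hasNb js e ρ) (isSelf js e ρ) s) ::
        ((cells js fun j => newEntry m (e j) (ρ j)).reverse ++ y)) [] (cells js ρ).reverse
        (newMode m (hasNb js e ρ) (hasCommon js e ρ) s)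
  rw [List.reverse_reverse, List.append_nil] at h3
  exact ((h1.trans h2).trans h3).mono (by simp; omega)

theorem run_pass_nil (m : Mode) : Run 1 (.pass m false false false) (stk [] [] y r q)
    (afterPass m) (stk [] [] y r q) :=
  .step fun v => ⟨_, by simp [program, onCell]; rfl⟩

/-- A check changes neither entries nor statuses; only the flag accumulates. It is set by an
undeleted neighbour of the selected vertex that shares a one with the copied row. -/
theorem run_pass_chk (found : Bool) (js is : List ι) (e : ι → ι → Option Bool)
    (s : ι → Status) (ρ : ι → Option Bool) :
    Run (is.length * (2 * js.length + 2)) (.pass (.chk found) false false false)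
      (stk [] (rows js is e s) y (cells js ρ) [])
      (.pass (.chk (found || is.any fun i =>
        hasNb js (e i) ρ && hasCommon js (e i) ρ && (s i).isSome)) false false false)
      (stk [] [] ((rows js is e s).reverse ++ y) (cells js ρ) []) := by
  induction is generalizing found y with
  | nil => simpa using Run.refl _ _ _
  | cons i is ih =>
    have h := (run_pass_row (rows js is e s) y (.chk found) js (e i) ρ (s i)).trans (ih _ _)
    simp only [newEntry, newStatus, Bool.or_assoc] at h
    simp only [rows_cons, List.reverse_append, List.reverse_cons, List.append_assoc,
      List.nil_append, List.cons_append, List.any_cons]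
    exact h.mono (by simp only [List.length_cons]; exact le_of_eq (by ring))

theorem run_pass_upd (M : Option (Finset VState)) (js is : List ι) (e : ι → ι → Option Bool)
    (s : ι → Status) (ρ : ι → Option Bool) :
    Run (is.length * (2 * js.length + 2)) (.pass (.upd M) false false false)
      (stk [] (rows js is e s) y (cells js ρ) [])
      (.pass (.upd M) false false false)
      (stk [] [] ((rows js is (fun i j => newEntry (.upd M) (e i j) (ρ j))
        (fun i => newStatus (.upd M) (hasNb js (e i) ρ) (isSelf js (e i) ρ) (s i))).reverse ++ y)
        (cells js ρ) []) := by
  induction is generalizing y with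
  | nil => simpa using Run.refl _ _ _
  | cons i is ih =>
    have h := (run_pass_row (rows js is e s) y (.upd M) js (e i) ρ (s i)).trans (ih _)
    simp only [rows_cons, List.reverse_append, List.reverse_cons, List.append_assoc,
      List.nil_append, List.cons_append]
    exact h.mono (by simp only [List.length_cons]; exact le_of_eq (by ring))

/-- The number of ones in a row. -/
def ones (js : List ι) (e : ι → Option Bool) : ℕ := js.countP fun j => e j == some true

/-- Truncation at three commutes with counting, so the finite control recognises the degrees `0`,
`1` and `2`. -/
theorem bump_cap (e : Option Bool) (k : ℕ) :
    bump e (cap k) = cap (k + if e = some true then 1 else 0) := by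
  unfold bump
  split_ifs with h
  · apply Fin.ext
    simp only [cap]
    omega
  · rfl

theorem run_sel_entries (alive : Bool) (k : ℕ) (js : List ι) (e : ι → Option Bool) :
    Run js.length (.sel (cap k) alive) (stk [] (cells js e ++ x) y r q)
      (.sel (cap (k + ones js e)) alive) (stk [] x ((cells js e).reverse ++ y) r q) := by
  induction js generalizing k y with
  | nil => simpa [ones] using Run.refl _ _ _
  | cons j js ih =>
    have h : Run 1 (.sel (cap k) alive) (stk [] (.ent (e j) :: (cells js e ++ x)) y r q)
        (.sel (bump (e j) (cap k)) alive) (stk [] (cells js e ++ x) (.ent (e j) :: y) r q) :=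
      .step fun v => ⟨_, by simp [program, onCell, fst, Cell.isEnt, Cell.entry]; rfl⟩
    rw [bump_cap] at h
    have h' := h.trans (ih _ _)
    have : k + ones (j :: js) e = k + (if e j = some true then 1 else 0) + ones js e := by
      simp only [ones, List.countP_cons, beq_iff_eq]; omega
    rw [this]
    simp only [cells_cons, List.reverse_cons, List.append_assoc, List.cons_append, List.nil_append]
    exact h'.mono (by simp only [List.length_cons]; omega)

theorem run_copy_entries (m : Mode) (js : List ι) (e : ι → Option Bool) :
    Run js.length (.copy m) (stk [] x ((cells js e).reverse ++ y) r q)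
      (.copy m) (stk [] (cells js e ++ x) y (cells js e ++ r) q) := by
  induction js generalizing y with
  | nil => exact Run.refl _ _ _
  | cons j js ih =>
    have h : Run 1 (.copy m) (stk [] (cells js e ++ x) (.ent (e j) :: y) (cells js e ++ r) q)
        (.copy m) (stk [] (.ent (e j) :: (cells js e ++ x)) y (.ent (e j) :: (cells js e ++ r)) q) :=
      .step fun v => ⟨_, by simp [program, onCell, fst, Cell.isEnt]; rfl⟩
    simp only [cells_cons, List.reverse_cons, List.append_assoc, List.cons_append, List.nil_append]
    exact ((ih _).trans h).mono (by simp only [List.length_cons]; omega)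

/-- Copying backwards stops at the end of the preceding row, or at the bottom of the stack for the
first row. -/
theorem run_copy_end (m : Mode) (hy : ∀ c ∈ y.head?, ∃ s, c = .rowEnd s) :
    Run 1 (.copy m) (stk [] x y r q) (.rew (some m)) (stk [] x y r q) := by
  cases y with
  | nil => exact .step fun v => ⟨_, by simp [program, onCell]; rfl⟩
  | cons c y =>
    obtain ⟨s, rfl⟩ := hy c (by simp)
    exact .step fun v => ⟨_, by simp [program, onCell, fst, Cell.isEnt]; rfl⟩

/-- The selection of a vertex: either no vertex among `is` qualifies, or the first one that does
is selected, and its row is copied. -/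
theorem run_sel (alive : Bool) (js is : List ι) (e : ι → ι → Option Bool) (s : ι → Status)
    (hy : ∀ c ∈ y.head?, ∃ t, c = .rowEnd t) :
    ((∀ i ∈ is, selectable (s i) (cap (ones js (e i))) = false) ∧
      Run (is.length * (js.length + 1) + 1) (.sel 0 alive) (stk [] (rows js is e s) y [] [])
        (.fin !(alive || is.any fun i => (s i).isSome))
        (stk [] [] ((rows js is e s).reverse ++ y) [] [])) ∨
    ∃ i ∈ is, selectable (s i) (cap (ones js (e i))) = true ∧ ∃ x' y',
      y'.reverse ++ x' = y.reverse ++ rows js is e s ∧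
      Run (is.length * (js.length + 1) + js.length + 2) (.sel 0 alive)
        (stk [] (rows js is e s) y [] []) (.rew (some (modeOf (s i) (cap (ones js (e i))))))
        (stk [] x' y' (cells js (e i)) []) := by
  induction is generalizing alive y with
  | nil =>
    refine .inl ⟨by simp, ?_⟩
    simp only [rows_nil, List.any_nil, Bool.or_false, List.reverse_nil, List.nil_append]
    exact (Run.step fun v => ⟨_, by simp [program, onCell]; rfl⟩ : Run 1 _ _ _ _).mono (by simp)
  | cons i is ih =>
    have h1 := run_sel_entries (.rowEnd (s i) :: rows js is e s) y [] [] alive 0 js (e i)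
    rw [Nat.zero_add, show cap 0 = 0 from rfl] at h1
    cases hsel : selectable (s i) (cap (ones js (e i))) with
    | true =>
      right
      have h2 : Run 1 (.sel (cap (ones js (e i))) alive)
          (stk [] (.rowEnd (s i) :: rows js is e s) ((cells js (e i)).reverse ++ y) [] [])
          (.copy (modeOf (s i) (cap (ones js (e i)))))
          (stk [] (.rowEnd (s i) :: rows js is e s) ((cells js (e i)).reverse ++ y) [] []) :=
        .step fun v => ⟨_, by simp [program, onCell, fst, Cell.isEnt, Cell.status, hsel]; rfl⟩
      have h3 := run_copy_entries (.rowEnd (s i) :: rows js is e s) y [] []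
        (modeOf (s i) (cap (ones js (e i)))) js (e i)
      rw [List.append_nil] at h3
      have h4 := run_copy_end (cells js (e i) ++ .rowEnd (s i) :: rows js is e s) y
        (cells js (e i)) [] (modeOf (s i) (cap (ones js (e i)))) hy
      rw [rows_cons]
      -- The matrix is now split between two stacks. Only the concatenation matters, since the
      -- rewinding restores it.
      refine ⟨i, by simp, hsel, _, y, rfl, (((h1.trans h2).trans h3).trans h4).mono ?_⟩
      · simp only [List.length_cons, Nat.succ_mul]; omega
    | false =>
      have h2 : Run 1 (.sel (cap (ones js (e i))) alive)
          (stk [] (.rowEnd (s i) :: rows js is e s) ((cells js (e i)).reverse ++ y) [] [])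
          (.sel 0 (alive || (s i).isSome))
          (stk [] (rows js is e s) (.rowEnd (s i) :: ((cells js (e i)).reverse ++ y)) [] []) :=
        .step fun v => ⟨_, by simp [program, onCell, fst, Cell.isEnt, Cell.status, hsel]; rfl⟩
      have h12 := h1.trans h2
      rcases ih (.rowEnd (s i) :: ((cells js (e i)).reverse ++ y)) (alive || (s i).isSome)
        (by simp) with ⟨hno, h3⟩ | ⟨k, hk, hsk, x', y', hxy, h3⟩
      · refine .inl ⟨by simpa [hsel] using hno, ?_⟩
        simp only [rows_cons, List.reverse_append, List.reverse_cons, List.append_assoc,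
          List.nil_append, List.cons_append, List.any_cons]
        rw [Bool.or_assoc] at h3
        exact (h12.trans h3).mono (by simp only [List.length_cons, Nat.succ_mul]; omega)
      · refine .inr ⟨k, by simp [hk], hsk, x', y', ?_, ?_⟩
        · rw [hxy]; simp [rows_cons]
        · rw [rows_cons]
          exact (h12.trans h3).mono (by simp only [List.length_cons, Nat.succ_mul]; omega)

/-- A pass that updates the matrix, and the return to the selection. -/
theorem run_upd (M : Option (Finset VState)) (js : List ι) (e : ι → ι → Option Bool)
    (s : ι → Status) (ρ : ι → Option Bool) :
    Run (5 * (js.length + 1) ^ 2) (.pass (.upd M) false false false)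
      (stk [] (rows js js e s) [] (cells js ρ) []) (.sel 0 false)
      (stk [] (rows js js (fun i j => newEntry (.upd M) (e i j) (ρ j))
        (fun i => newStatus (.upd M) (hasNb js (e i) ρ) (isSelf js (e i) ρ) (s i))) [] [] []) := by
  have h1 := run_pass_upd [] M js js e s ρ
  rw [List.append_nil] at h1
  have h2 := run_clear [] [] (rows js js (fun i j => newEntry (.upd M) (e i j) (ρ j))
        (fun i => newStatus (.upd M) (hasNb js (e i) ρ) (isSelf js (e i) ρ) (s i))).reverse
        (cells js ρ) []
  have h3 := run_rew [] [] (rows js js (fun i j => newEntry (.upd M) (e i j) (ρ j))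
        (fun i => newStatus (.upd M) (hasNb js (e i) ρ) (isSelf js (e i) ρ) (s i))).reverse
        [] [] none
  rw [List.reverse_reverse, List.append_nil] at h3
  refine (((h1.trans (run_pass_nil _ _ _ _)).trans h2).trans h3).mono ?_
  simp only [length_cells, List.length_reverse, length_rows]
  nlinarith

/-- The message that the neighbours of a selected vertex absorb. -/
def message (js : List ι) (e : ι → ι → Option Bool) (s : ι → Status) (v : ι) :
    Option (Finset VState) :=
  match modeOf (s v) (cap (ones js (e v))) with
  | .upd M => M
  | .chk _ => if (js.any fun i =>
      hasNb js (e i) (e v) && hasCommon js (e i) (e v) && (s i).isSome) then some {(2, ∅)} else none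

/-- One round of the machine. -/
theorem run_round (js : List ι) (e : ι → ι → Option Bool) (s : ι → Status) :
    ((∀ i ∈ js, selectable (s i) (cap (ones js (e i))) = false) ∧
      Run ((js.length + 1) ^ 2) (.sel 0 false) (stk [] (rows js js e s) [] [] [])
        (.fin !(js.any fun i => (s i).isSome)) (stk [] [] (rows js js e s).reverse [] [])) ∨
    ∃ v ∈ js, selectable (s v) (cap (ones js (e v))) = true ∧
      Run (12 * (js.length + 1) ^ 2) (.sel 0 false) (stk [] (rows js js e s) [] [] [])
        (.sel 0 false)
        (stk [] (rows js js
          (fun i j => newEntry (.upd (message js e s v)) (e i j) (e v j))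
          (fun i => newStatus (.upd (message js e s v)) (hasNb js (e i) (e v))
            (isSelf js (e i) (e v)) (s i))) [] [] []) := by
  rcases run_sel [] false js js e s (by simp) with ⟨h, h1⟩ | ⟨v, hv, hsel, x', y', hxy, h1⟩
  · refine .inl ⟨h, ?_⟩
    rw [List.append_nil, Bool.false_or] at h1
    exact h1.mono (by nlinarith)
  · refine .inr ⟨v, hv, hsel, ?_⟩
    have h2 := run_rew [] x' y' (cells js (e v)) [] (some (modeOf (s v) (cap (ones js (e v)))))
    have hlen : y'.length ≤ js.length * (js.length + 1) := by
      have := congrArg List.length hxy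
      simp [length_rows] at this
      omega
    rw [hxy, List.reverse_nil, List.nil_append] at h2
    have h12 := h1.trans h2
    unfold message
    cases hm : modeOf (s v) (cap (ones js (e v))) with
    | upd M =>
      rw [hm] at h12
      exact (h12.trans (run_upd M js e s (e v))).mono (by nlinarith)
    | chk found =>
      -- `modeOf` starts every check with the flag unset.
      have hf : found = false := by
        unfold modeOf at hm; split_ifs at hm; simpa using hm.symm
      subst hf
      rw [hm] at h12
      have h3 := run_pass_chk [] false js js e s (e v)
      rw [List.append_nil, Bool.false_or] at h3
      have h4 := run_rew [] [] (rows js js e s).reverse (cells js (e v)) [] (some (.upd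
        (if (js.any fun i => hasNb js (e i) (e v) && hasCommon js (e i) (e v) && (s i).isSome)
          then some {(2, ∅)} else none)))
      rw [List.reverse_reverse, List.append_nil, List.length_reverse, length_rows] at h4
      exact ((((h12.trans h3).trans (run_pass_nil _ _ _ _)).trans h4).trans
        (run_upd _ js e s (e v))).mono (by nlinarith)

end Loops


/-! ### Reading the input and marking the diagonal -/

section Read

variable {ι : Type*} (inp : List (Option Bool)) (x y r q : List Cell)

theorem run_read_after (js : List ι) (b : ι → Bool) :
    Run js.length (.read true) (stk ((js.map fun j => some (b j)) ++ inp) x y r q)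
      (.read true) (stk inp x ((cells js fun j => some (b j)).reverse ++ y) r q) := by
  induction js generalizing y with
  | nil => exact Run.refl _ _ _
  | cons j js ih =>
    simp only [cells_cons, List.map_cons, List.reverse_cons, List.append_assoc, List.cons_append,
      List.nil_append]
    exact ((run_read_true _ x y r q (b j)).trans (ih _)).mono
      (by simp only [List.length_cons]; omega)

theorem run_read_before (js : List ι) (b : ι → Bool) :
    Run js.length (.read false)
      (stk ((js.map fun j => some (b j)) ++ inp) x y (cells js (fun _ => none) ++ r) q)
      (.read false) (stk inp x ((cells js fun j => some (b j)).reverse ++ y) r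
        ((cells js fun _ => none).reverse ++ q)) := by
  induction js generalizing y q with
  | nil => exact Run.refl _ _ _
  | cons j js ih =>
    simp only [cells_cons, List.map_cons, List.reverse_cons, List.append_assoc, List.cons_append,
      List.nil_append]
    exact ((run_read_false _ x y _ q (b j) _).trans (ih _ _)).mono
      (by simp only [List.length_cons]; omega)

theorem cells_none (js : List ι) :
    cells js (fun _ => none) = List.replicate js.length (.ent none) := List.map_const' ..

open Classical in
/-- The adjacency matrix with marked diagonal. -/
noncomputable def initEntry {n : ℕ} (G : SimpleGraph (Fin n)) (i j : Fin n) : Option Bool :=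
  if j = i then none else some (decide (G.Adj i j))

/-- The initial status of every vertex. -/
def initStatus {n : ℕ} (_ : Fin n) : Status := some (false, freshStates)

-- The counter has the length of `pre`, so it is exhausted precisely at column `i`.
open Classical in
theorem run_read_row {n : ℕ} (G : SimpleGraph (Fin n)) (pre post : List (Fin n)) (i : Fin n)
    (h : pre ++ i :: post = List.finRange n) :
    Run (2 * n + 2) (.read false)
      (stk (((List.finRange n).map fun j => some (decide (G.Adj i j))) ++ none :: inp) [] y
        (List.replicate pre.length (.ent none)) [])
      (.read false) (stk inp [] (.rowEnd (initStatus i) ::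
        ((cells (List.finRange n) (initEntry G i)).reverse ++ y))
        (List.replicate (pre ++ [i]).length (.ent none)) []) := by
  have hnd : (pre ++ i :: post).Nodup := h ▸ List.nodup_finRange n
  have hlen : pre.length + (post.length + 1) = n := by
    simpa using congrArg List.length h
  have hrow : cells (List.finRange n) (initEntry G i) =
      cells pre (fun j => some (decide (G.Adj i j))) ++
        .ent none :: cells post (fun j => some (decide (G.Adj i j))) := by
    rw [← h]
    have h1 : ∀ j ∈ pre, j ≠ i := fun j hj he =>
      (List.nodup_append.1 hnd).2.2 j hj i (by simp) he
    have h2 : ∀ j ∈ post, j ≠ i := fun j hj he =>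
      (List.nodup_cons.1 (List.nodup_append.1 hnd).2.1).1 (he ▸ hj)
    unfold cells
    rw [List.map_append, List.map_cons]
    congr 1
    · exact List.map_congr_left fun j hj => by simp [initEntry, h1 j hj]
    · congr 1
      · simp [initEntry]
      · exact List.map_congr_left fun j hj => by simp [initEntry, h2 j hj]
  rw [hrow, ← h]
  have h1 := run_read_before (some (decide (G.Adj i i)) ::
    ((post.map fun j => some (decide (G.Adj i j))) ++ none :: inp)) [] y [] [] pre
    (fun j => decide (G.Adj i j))
  rw [List.append_nil, List.append_nil, cells_none, List.reverse_replicate] at h1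
  have h2 := h1.trans (run_read_diag _ [] _ _ _)
  have h3 := h2.trans (run_read_after (none :: inp) [] _ [] _ post
    (fun j => decide (G.Adj i j)))
  have h4 := (h3.trans (run_read_stop inp _ _ _ _ true)).trans (run_back _ _ _ _ _)
  rw [List.append_nil, List.reverse_replicate, ← List.replicate_succ] at h4
  simp only [List.map_append, List.map_cons, List.append_assoc, List.cons_append,
    List.reverse_append, List.reverse_cons, List.nil_append, List.length_append,
    List.length_singleton]
  exact h4.mono (by simp only [List.length_replicate]; omega)

theorem run_read_rows {n : ℕ} (G : SimpleGraph (Fin n)) (pre is : List (Fin n))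
    (h : pre ++ is = List.finRange n) :
    Run (is.length * (2 * n + 2) + 1) (.read false)
      (stk (is.flatMap fun i => ((List.finRange n).map fun j => some (@decide (G.Adj i j)
        (Classical.propDecidable _))) ++ [none]) [] y
        (List.replicate pre.length (.ent none)) [])
      .clear (stk [] [] ((rows (List.finRange n) is (initEntry G) initStatus).reverse ++ y)
        (List.replicate n (.ent none)) []) := by
  induction is generalizing pre y with
  | nil =>
    have : pre.length = n := by simpa using congrArg List.length h
    rw [this]
    exact (run_read_nil _ _ _ _ _).mono (by simp)
  | cons i is ih =>
    have h1 := run_read_row (is.flatMap fun i => ((List.finRange n).map fun j =>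
      some (@decide (G.Adj i j) (Classical.propDecidable _))) ++ [none]) y G pre is i h
    have h2 := h1.trans (ih _ (pre ++ [i]) (by simpa using h))
    simp only [rows_cons, List.flatMap_cons, List.append_assoc, List.cons_append,
      List.reverse_append, List.reverse_cons, List.nil_append]
    exact h2.mono (by simp only [List.length_cons]; exact le_of_eq (by ring))

/-- Reading the input. -/
theorem run_init {n : ℕ} (G : SimpleGraph (Fin n)) :
    Run (4 * (n + 1) ^ 2) (.read false) (stk (encodeGraph G) [] [] [] []) (.sel 0 false)
      (stk [] (rows (List.finRange n) (List.finRange n) (initEntry G) initStatus) [] [] []) := by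
  have h1 := run_read_rows [] G [] (List.finRange n) rfl
  rw [List.append_nil] at h1
  have h2 := (h1.trans (run_clear _ _ _ _ _)).trans (run_rew _ _ _ _ _ _)
  rw [List.reverse_reverse, List.append_nil] at h2
  refine h2.mono ?_
  simp only [List.length_replicate, List.length_reverse, length_rows, List.length_finRange]
  nlinarith

end Read

/-! ### Correctness of the rounds -/

section Rounds

variable {n : ℕ}

/-- The vertices that have not been deleted. -/
def aliveSet (s : Fin n → Status) : Set (Fin n) := {i | (s i).isSome}

/-- The sets of states. -/
def states (s : Fin n → Status) (i : Fin n) : Finset VState := (s i).elim ∅ Prod.snd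

/-- The matrix `e` and the statuses `s` describe what remains of `G`. -/
structure Inv (G : SimpleGraph (Fin n)) (e : Fin n → Fin n → Option Bool) (s : Fin n → Status) :
    Prop where
  diag : ∀ i j, e i j = none ↔ i = j
  adj : ∀ i ∈ aliveSet s, ∀ j, e i j = some true ↔ G.Adj i j ∧ j ∈ aliveSet s
  fresh : ∀ i ∈ aliveSet s, AllowsTwo (states s i) → states s i = freshStates
  marked : ∀ i S, s i = some (true, S) → ∀ a ∈ aliveSet s, ∀ b ∈ aliveSet s,
    G.Adj i a → G.Adj i b → ¬ G.Adj a b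

theorem inv_init (G : SimpleGraph (Fin n)) : Inv G (initEntry G) initStatus where
  diag i j := by
    unfold initEntry
    split_ifs with h
    · simp [h]
    · simpa using Ne.symm h
  adj i _ j := by
    unfold initEntry
    split_ifs with h
    · simp [h]
    · simp [aliveSet, initStatus]
  fresh i _ _ := rfl
  marked i S h := by simp [initStatus] at h

theorem ones_eq_card (e : Fin n → Option Bool) :
    ones (List.finRange n) e = (Finset.univ.filter fun j => e j = some true).card := by
  rw [ones, List.countP_eq_length_filter,
    ← List.toFinset_card_of_nodup ((List.nodup_finRange n).filter _)]
  congr 1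
  ext j
  simp

theorem cap_le_one {d : ℕ} : cap d ≤ 1 ↔ d ≤ 1 := by
  rw [Fin.le_def]; simp [cap]

theorem cap_eq_two {d : ℕ} : cap d = 2 ↔ d = 2 := by
  rw [Fin.ext_iff]; simp only [cap]; change min 3 d = 2 ↔ _; omega

theorem selectable_iff {s : Status} {d : ℕ} : selectable s (cap d) = true ↔
    ∃ t, s = some t ∧ t.2.Nonempty ∧ (d ≤ 1 ∨ (d = 2 ∧ AllowsTwo t.2 ∧ t.1 = false)) := by
  cases s with
  | none => simp [selectable]
  | some t => simp [selectable, cap_le_one, cap_eq_two]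

variable {G : SimpleGraph (Fin n)} {e : Fin n → Fin n → Option Bool} {s : Fin n → Status}

/-- The diagonal letter of row `v` singles out column `v`. -/
theorem Inv.hasNb_iff (h : Inv G e s) (i v : Fin n) :
    hasNb (List.finRange n) (e i) (e v) = true ↔ e i v = some true := by
  simp [hasNb, h.diag]

theorem Inv.isSelf_iff (h : Inv G e s) (i v : Fin n) :
    isSelf (List.finRange n) (e i) (e v) = true ↔ i = v := by
  simp only [isSelf, List.any_eq_true, List.mem_finRange, true_and, Bool.and_eq_true, beq_iff_eq,
    h.diag]
  exact ⟨fun ⟨j, h1, h2⟩ => h2.trans h1.symm, fun hi => ⟨v, rfl, hi⟩⟩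

theorem Inv.ones_le_one (h : Inv G e s) {v : Fin n} (hv : v ∈ aliveSet s) :
    ones (List.finRange n) (e v) ≤ 1 ↔
      ∀ a ∈ aliveSet s, ∀ b ∈ aliveSet s, G.Adj v a → G.Adj v b → a = b := by
  rw [ones_eq_card, Finset.card_le_one]
  simp only [Finset.mem_filter, Finset.mem_univ, true_and, h.adj v hv]
  exact ⟨fun H a ha b hb hva hvb => H a ⟨hva, ha⟩ b ⟨hvb, hb⟩,
    fun H a ha b hb => H a ha.2 b hb.2 ha.1 hb.1⟩

theorem Inv.ones_eq_two (h : Inv G e s) {v : Fin n} (hv : v ∈ aliveSet s) :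
    ones (List.finRange n) (e v) = 2 ↔
      ∃ a ∈ aliveSet s, ∃ b ∈ aliveSet s, a ≠ b ∧ G.Adj v a ∧ G.Adj v b ∧
        ∀ x ∈ aliveSet s, G.Adj v x → x = a ∨ x = b := by
  rw [ones_eq_card, Finset.card_eq_two]
  simp only [Finset.ext_iff, Finset.mem_filter, Finset.mem_univ, true_and, h.adj v hv,
    Finset.mem_insert, Finset.mem_singleton]
  constructor
  · rintro ⟨a, b, hab, H⟩
    have ha := (H a).2 (.inl rfl)
    have hb := (H b).2 (.inr rfl)
    exact ⟨a, ha.2, b, hb.2, hab, ha.1, hb.1, fun x hx hvx => (H x).1 ⟨hvx, hx⟩⟩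
  · rintro ⟨a, ha, b, hb, hab, hva, hvb, H⟩
    refine ⟨a, b, hab, fun x => ⟨fun hx => H x hx.2 hx.1, ?_⟩⟩
    rintro (rfl | rfl)
    exacts [⟨hva, ha⟩, ⟨hvb, hb⟩]

/-- A common one of two adjacent undeleted vertices is the third vertex of a triangle. The test of
`s i` is needed because the row of a deleted vertex may still contain ones. -/
theorem Inv.common_iff (h : Inv G e s) {v : Fin n} (hv : v ∈ aliveSet s) :
    ((List.finRange n).any fun i => hasNb (List.finRange n) (e i) (e v) &&
      hasCommon (List.finRange n) (e i) (e v) && (s i).isSome) = true ↔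
    ∃ a ∈ aliveSet s, ∃ b ∈ aliveSet s, G.Adj v a ∧ G.Adj v b ∧ G.Adj a b := by
  simp only [List.any_eq_true, List.mem_finRange, true_and, Bool.and_eq_true, h.hasNb_iff,
    hasCommon, beq_iff_eq]
  constructor
  · rintro ⟨a, ⟨h1, b, h2, h3⟩, ha⟩
    have h1 := (h.adj a ha v).1 h1
    have h2 := (h.adj v hv b).1 h2
    have h3 := (h.adj a ha b).1 h3
    exact ⟨a, ha, b, h2.2, h1.1.symm, h2.1, h3.1⟩
  · rintro ⟨a, ha, b, hb, hva, hvb, hab⟩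
    exact ⟨a, ⟨(h.adj a ha v).2 ⟨hva.symm, hv⟩, b, (h.adj v hv b).2 ⟨hvb, hb⟩,
      (h.adj a ha b).2 ⟨hab, hb⟩⟩, ha⟩

theorem sat_congr {V : Type*} {G : SimpleGraph V} {W : Set V} {S S' : V → Finset VState}
    (h : ∀ v ∈ W, S v = S' v) : Sat G W S ↔ Sat G W S' := by
  have key : ∀ S S' : V → Finset VState, (∀ v ∈ W, S v = S' v) → Sat G W S → Sat G W S' :=
    fun S S' h ⟨f, u, hv⟩ => ⟨f, u, fun v hvW => h v hvW ▸ hv.mem v hvW, hv.proper, hv.unused,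
      hv.once⟩
  exact ⟨key S S' h, key S' S fun v hv => (h v hv).symm⟩

/-- The number of rounds that may still concern a vertex. -/
def weight (s : Status) : ℕ := s.elim 0 fun t => if t.1 then 1 else 2

theorem weight_map (s : Status) (f : Finset VState → Finset VState) :
    weight (s.map fun t => (t.1, f t.2)) = weight s := by
  cases s <;> rfl

/-- The matrix after the treatment of `v`. -/
def nextEntry (e : Fin n → Fin n → Option Bool) (M : Option (Finset VState)) (v i j : Fin n) :
    Option Bool := newEntry (.upd M) (e i j) (e v j)

/-- The statuses after the treatment of `v`. -/
def nextStatus (e : Fin n → Fin n → Option Bool) (s : Fin n → Status)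
    (M : Option (Finset VState)) (v i : Fin n) : Status :=
  newStatus (.upd M) (hasNb (List.finRange n) (e i) (e v))
    (isSelf (List.finRange n) (e i) (e v)) (s i)

section Remove

variable (h : Inv G e s) (M : Finset VState) (v : Fin n)

include h

theorem Inv.nextStatus_remove (i : Fin n) : nextStatus e s (some M) v i =
    if i = v then none else if e i v = some true then (s i).map fun t => (t.1, absorb t.2 M)
    else s i := by
  unfold nextStatus newStatus
  simp only [h.isSelf_iff, h.hasNb_iff]

theorem Inv.aliveSet_remove : aliveSet (nextStatus e s (some M) v) = aliveSet s \ {v} := by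
  ext i
  simp only [aliveSet, Set.mem_ofPred_eq, h.nextStatus_remove, Set.mem_sdiff,
    Set.mem_singleton_iff]
  split_ifs <;> simp_all

theorem Inv.states_remove (hv : v ∈ aliveSet s) : ∀ i ∈ aliveSet s \ {v},
    states (nextStatus e s (some M) v) i = removeStates G v M (states s) i := by
  rintro i ⟨hi, hiv⟩
  have hadj := h.adj i hi v
  unfold states removeStates
  rw [h.nextStatus_remove, if_neg (show i ≠ v from hiv)]
  by_cases hG : G.Adj i v
  · rw [if_pos (hadj.2 ⟨hG, hv⟩), if_pos hG]
    obtain ⟨t, ht⟩ := Option.isSome_iff_exists.1 hi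
    simp only [ht]; rfl
  · rw [if_neg fun h' => hG (hadj.1 h').1, if_neg hG]

/-- Deletion clears a column but not the row, which is why `adj` speaks of undeleted rows only. A
table that has absorbed a message no longer allows colour `2`, and marks persist because no triangle
is created. -/
theorem Inv.remove (hv : v ∈ aliveSet s) :
    Inv G (nextEntry e (some M) v) (nextStatus e s (some M) v) where
  diag i j := by
    unfold nextEntry newEntry
    simp only [h.diag, ne_eq]
    split_ifs with h1
    · simpa using h1.2
    · exact h.diag i j
  adj i hi j := by
    rw [h.aliveSet_remove] at hi ⊢
    have h1 := h.adj i hi.1 j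
    unfold nextEntry newEntry
    simp only [h.diag, ne_eq, Set.mem_sdiff, Set.mem_singleton_iff]
    split_ifs with h2
    · simp [h2.1]
    · rw [h1]
      constructor
      · rintro ⟨h3, h4⟩
        refine ⟨h3, h4, ?_⟩
        rintro rfl
        exact h2 ⟨rfl, h3.ne⟩
      · exact fun h3 => ⟨h3.1, h3.2.1⟩
  fresh i hi := by
    rw [h.aliveSet_remove] at hi
    rw [h.states_remove M v hv i hi]
    unfold removeStates
    split_ifs
    · exact fun h' => absurd h' (not_allowsTwo_absorb _ _)
    · exact h.fresh i hi.1
  marked i S hi a ha b hb := by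
    rw [h.aliveSet_remove] at ha hb
    rw [h.nextStatus_remove] at hi
    split_ifs at hi with h1 h2
    · obtain ⟨⟨t1, t2⟩, ht, ht'⟩ := Option.map_eq_some_iff.1 hi
      obtain rfl : t1 = true := congrArg Prod.fst ht'
      exact h.marked i _ ht a ha.1 b hb.1
    · exact h.marked i S hi a ha.1 b hb.1

theorem Inv.weight_remove (hv : v ∈ aliveSet s) :
    ∑ i, weight (nextStatus e s (some M) v i) < ∑ i, weight (s i) := by
  refine Finset.sum_lt_sum (fun i _ => ?_) ⟨v, Finset.mem_univ _, ?_⟩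
  · rw [h.nextStatus_remove]
    split_ifs
    · simp [weight]
    · exact (weight_map (s i) fun S => absorb S M).le
    · rfl
  · rw [h.nextStatus_remove, if_pos rfl]
    obtain ⟨t, ht⟩ := Option.isSome_iff_exists.1 hv
    rw [ht]
    simp only [weight, Option.elim_none, Option.elim_some]
    split_ifs <;> omega

theorem Inv.nextStatus_mark (i : Fin n) : nextStatus e s none v i =
    if i = v then (s i).map fun t => (true, t.2) else s i := by
  unfold nextStatus newStatus
  simp only [h.isSelf_iff]

theorem Inv.aliveSet_mark : aliveSet (nextStatus e s none v) = aliveSet s := by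
  ext i
  simp only [aliveSet, Set.mem_ofPred_eq, h.nextStatus_mark]
  split_ifs <;> simp

theorem Inv.states_mark : states (nextStatus e s none v) = states s := by
  funext i
  simp only [states, h.nextStatus_mark]
  split_ifs
  · cases s i <;> rfl
  · rfl

theorem Inv.mark (hno : ∀ a ∈ aliveSet s, ∀ b ∈ aliveSet s, G.Adj v a → G.Adj v b → ¬ G.Adj a b) :
    Inv G (nextEntry e none v) (nextStatus e s none v) where
  diag := h.diag
  adj := by rw [h.aliveSet_mark]; exact h.adj
  fresh := by rw [h.aliveSet_mark, h.states_mark]; exact h.fresh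
  marked i S hi := by
    rw [h.aliveSet_mark]
    rw [h.nextStatus_mark] at hi
    split_ifs at hi with h1
    · exact h1 ▸ hno
    · exact h.marked i S hi

theorem Inv.weight_mark {S : Finset VState} (hv : s v = some (false, S)) :
    ∑ i, weight (nextStatus e s none v i) < ∑ i, weight (s i) := by
  refine Finset.sum_lt_sum (fun i _ => ?_) ⟨v, Finset.mem_univ _, ?_⟩
  · rw [h.nextStatus_mark]
    split_ifs
    · cases s i
      · exact le_rfl
      · simp only [weight, Option.map_some, Option.elim_some]
        split_ifs <;> simp_all
    · rfl
  · rw [h.nextStatus_mark, if_pos rfl, hv]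
    simp [weight]

/-- A round preserves the description and the satisfiability, and makes progress. -/
theorem Inv.round
    (hsel : selectable (s v) (cap (ones (List.finRange n) (e v))) = true) :
    Inv G (nextEntry e (message (List.finRange n) e s v) v)
      (nextStatus e s (message (List.finRange n) e s v) v) ∧
    (Sat G (aliveSet s) (states s) ↔
      Sat G (aliveSet (nextStatus e s (message (List.finRange n) e s v) v))
        (states (nextStatus e s (message (List.finRange n) e s v) v))) ∧
    ∑ i, weight (nextStatus e s (message (List.finRange n) e s v) v i) < ∑ i, weight (s i) := by
  obtain ⟨t, ht, hne, hcase⟩ := selectable_iff.1 hsel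
  have hv : v ∈ aliveSet s := by simp [aliveSet, ht]
  have hst : states s v = t.2 := by simp [states, ht]
  have hrem : ∀ M, (Sat G (aliveSet s) (states s) ↔
      Sat G (aliveSet s \ {v}) (removeStates G v M (states s))) →
      Inv G (nextEntry e (some M) v) (nextStatus e s (some M) v) ∧
      (Sat G (aliveSet s) (states s) ↔
        Sat G (aliveSet (nextStatus e s (some M) v)) (states (nextStatus e s (some M) v))) ∧
      ∑ i, weight (nextStatus e s (some M) v i) < ∑ i, weight (s i) := by
    intro M hM
    refine ⟨h.remove M v hv, ?_, h.weight_remove M v hv⟩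
    rw [h.aliveSet_remove, sat_congr (h.states_remove M v hv)]
    exact hM
  by_cases h1 : ones (List.finRange n) (e v) ≤ 1
  · have hm : message (List.finRange n) e s v = some (states s v) := by
      simp only [message, modeOf, cap_le_one, if_pos h1]; rfl
    rw [hm]
    exact hrem _ (sat_remove_leaf_iff hv (hst ▸ hne) ((h.ones_le_one hv).1 h1))
  · obtain ⟨h2, htwo, hmark⟩ := hcase.resolve_left h1
    have hm : message (List.finRange n) e s v =
        if ((List.finRange n).any fun i => hasNb (List.finRange n) (e i) (e v) &&
          hasCommon (List.finRange n) (e i) (e v) && (s i).isSome) then some {(2, ∅)}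
        else none := by
      simp only [message, modeOf, cap_le_one, if_neg h1]
    rw [hm]
    split_ifs with hc
    · obtain ⟨a, ha, b, hb, hab, hva, hvb, hdeg⟩ := (h.ones_eq_two hv).1 h2
      obtain ⟨c, hc, d, hd, hvc, hvd, hcd⟩ := (h.common_iff hv).1 hc
      refine hrem _ (sat_remove_ear_iff hv hc hd hvc hvd hcd (fun x hx hvx => ?_) h.fresh
        (hst ▸ htwo))
      have hne := hcd.ne
      -- The two triangle vertices are the two neighbours given by the degree count, in some order.
      rcases hdeg c hc hvc with rfl | rfl <;> rcases hdeg d hd hvd with rfl | rfl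
      · exact absurd rfl hne
      · exact hdeg x hx hvx
      · exact (hdeg x hx hvx).symm
      · exact absurd rfl hne
    · rw [h.common_iff hv] at hc
      refine ⟨h.mark v fun a ha b hb hva hvb hab => hc ⟨a, ha, b, hb, hva, hvb, hab⟩, ?_,
        h.weight_mark v (S := t.2) (by rw [ht, ← hmark])⟩
      rw [h.aliveSet_mark, h.states_mark]

end Remove

/-- When no vertex qualifies, a satisfiable instance is empty. -/
theorem Inv.sat_iff_of_stuck (h : Inv G e s) (hG : IsChordal G)
    (hstuck : ∀ i, selectable (s i) (cap (ones (List.finRange n) (e i))) = false) :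
    Sat G (aliveSet s) (states s) ↔ aliveSet s = ∅ := by
  constructor
  · intro hsat
    by_contra hne
    have hW := Set.nonempty_iff_ne_empty.2 hne
    have hno : ∀ v ∈ aliveSet s, ∀ d, d = ones (List.finRange n) (e v) →
        ¬ (d ≤ 1 ∨ (d = 2 ∧ AllowsTwo (states s v) ∧ ∃ S, s v = some (false, S))) := by
      rintro v hv d rfl hc
      obtain ⟨t, ht⟩ := Option.isSome_iff_exists.1 hv
      obtain ⟨f, u, hval⟩ := hsat
      -- A colouring draws a state from every table, so the nonemptiness test in `selectable` cannot
      -- be what fails.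
      have hm := hval.mem v hv
      have hst : states s v = t.2 := by simp [states, ht]
      refine Bool.false_ne_true ((hstuck v).symm.trans
        (selectable_iff.2 ⟨t, ht, ⟨_, hst ▸ hm⟩, hc.imp_right ?_⟩))
      rintro ⟨h1, h2, S, h3⟩
      rw [ht] at h3
      exact ⟨h1, hst ▸ h2, by rw [Option.some.inj h3]⟩
    rcases hsat.exists_leaf_or_ear hG hW with ⟨v, hv, hleaf⟩ |
      ⟨v, hv, htwo, a, ha, b, hb, hab, hva, hvb, hadj, hdeg⟩
    · exact hno v hv _ rfl (.inl ((h.ones_le_one hv).2 hleaf))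
    · refine hno v hv _ rfl (.inr ⟨(h.ones_eq_two hv).2 ⟨a, ha, b, hb, hab, hva, hvb, hdeg⟩,
        htwo, ?_⟩)
      obtain ⟨⟨m, S⟩, ht⟩ := Option.isSome_iff_exists.1 hv
      cases m with
      | false => exact ⟨S, ht⟩
      | true => exact absurd hadj (h.marked v S ht a ha b hb hva hvb)
  · intro he
    rw [he]
    exact ⟨fun _ => 0, fun _ => ∅, by simp, by simp, by simp, by simp⟩

/-- All rounds. -/
theorem Inv.run_rounds (hG : IsChordal G) (k : ℕ) (h : Inv G e s)
    (hk : ∑ i, weight (s i) ≤ k) :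
    ∃ ans y, (ans = true ↔ Sat G (aliveSet s) (states s)) ∧ y.length = n * (n + 1) ∧
      Run ((k + 1) * (12 * (n + 1) ^ 2)) (.sel 0 false)
        (stk [] (rows (List.finRange n) (List.finRange n) e s) [] [] []) (.fin ans)
        (stk [] [] y [] []) := by
  induction k generalizing e s with
  | zero | succ k ih =>
    rcases run_round (List.finRange n) e s with ⟨hno, hrun⟩ | ⟨v, -, hsel, hrun⟩
    · refine ⟨_, _, ?_, ?_, hrun.mono ?_⟩
      · rw [h.sat_iff_of_stuck hG fun i => hno i (List.mem_finRange i)]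
        simp [aliveSet, Set.eq_empty_iff_forall_notMem]
      · simp [length_rows]
      · rw [List.length_finRange]
        nlinarith [Nat.zero_le ((n + 1) ^ 2)]
    · obtain ⟨hinv, hsat, hw⟩ := h.round v hsel
      -- For `k = 0` there is no weight left to lose, which is a contradiction; otherwise the
      -- induction hypothesis applies.
      first
      | omega
      | obtain ⟨ans, y, hans, hy, hrun'⟩ := ih hinv (by omega)
        refine ⟨ans, y, hans.trans hsat.symm, hy, (hrun.trans hrun').mono (le_of_eq ?_)⟩
        rw [List.length_finRange]
        ring

end Rounds

/-! ### Total running time and conclusion -/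

/-- The running time. -/
def runTime (n : ℕ) : ℕ := 40 * (n + 1) ^ 3

theorem machine_outputs {n : ℕ} {G : SimpleGraph (Fin n)} (hG : IsChordal G) :
    ∃ ans : Bool, (ans = true ↔ RSColourable G 3) ∧ ∃ j ≤ runTime n,
      (flip bind (TM2.step program))^[j]
        (some ⟨some (.read false), (none, none), stk (encodeGraph G) [] [] [] []⟩) =
      some ⟨none, (none, none), stk [] [] [] [] [] [ans]⟩ := by
  -- Every vertex starts with weight `2`.
  obtain ⟨ans, y, hans, hy, hrun⟩ := (inv_init G).run_rounds hG (2 * n)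
    (by simp [weight, initStatus, mul_comm])
  refine ⟨ans, ?_, ?_⟩
  · rw [hans, ← sat_univ_iff]
    have : aliveSet (initStatus (n := n)) = Set.univ := by
      ext i; simp [aliveSet, initStatus]
    rw [this]
    exact sat_congr fun v _ => rfl
  · obtain ⟨v, j, hj, h1⟩ := ((run_init G).trans hrun) (none, none)
    obtain ⟨j', hj', h2⟩ := run_fin [] [] y [] [] ans v
    refine ⟨j' + j, ?_, by rw [Function.iterate_add_apply, h1, h2]⟩
    rw [hy] at hj'
    unfold runTime
    -- Reading costs `4 * (n + 1) ^ 2`, the `2 * n + 1` rounds `12 * (n + 1) ^ 2` each, and emptying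
    -- `y` costs `n * (n + 1) + 1`.
    nlinarith [Nat.zero_le (n ^ 3), Nat.zero_le (n ^ 2)]

/-- The machine with its alphabets. -/
def machineAux : TM2ComputableAux (Option Bool) Bool where
  tm := machine
  inputAlphabet := Equiv.refl (Option Bool)
  outputAlphabet := Equiv.refl Bool

theorem initList_machine (L : List (Option Bool)) :
    initList machine L = ⟨some (.read false), (none, none), stk L [] [] [] []⟩ := by
  unfold initList
  congr 1
  funext k
  cases k <;> rfl

theorem haltList_machine (L : List Bool) :
    haltList machine L = ⟨none, (none, none), stk [] [] [] [] [] L⟩ := by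
  unfold haltList
  congr 1
  funext k
  cases k <;> rfl

theorem machine_decides : DecidesChordalInTime 3 machineAux runTime := by
  classical
  intro I
  obtain ⟨ans, hans, j, hj, h⟩ := machine_outputs I.2.2
  have hb : I.answer 3 = ans := by
    unfold ChordalInstance.answer
    cases ans <;> simp_all
  have hi : initList machineAux.tm (I.encode.map machineAux.inputAlphabet.invFun) =
      ⟨some (.read false), (none, none), stk (encodeGraph I.2.1) [] [] [] []⟩ :=
    (congrArg (initList machine) (List.map_id _)).trans (initList_machine _)
  have ho : haltList machineAux.tm ((Computability.encodeBool (I.answer 3)).map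
      machineAux.outputAlphabet.invFun) =
      ⟨none, (none, none), stk [] [] [] [] [] [ans]⟩ :=
    hb ▸ haltList_machine _
  exact ⟨⟨⟨j, (congrArg (fun c => (flip bind (TM2.step program))^[j] (some c)) hi).trans
    (h.trans (congrArg some ho.symm))⟩, hj⟩⟩

theorem length_encodeGraph {n : ℕ} (G : SimpleGraph (Fin n)) :
    (encodeGraph G).length = n * (n + 1) := by
  simp [encodeGraph, List.length_flatMap]

theorem runTime_isBigO :
    (fun n : ℕ => (runTime n : ℝ)) =O[Filter.atTop] fun n : ℕ => (n : ℝ) ^ 3 := by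
  -- The constant is `40 * 2 ^ 3`, as `n + 1 ≤ 2 * n` for `n ≥ 1`.
  refine Asymptotics.IsBigO.of_bound 320 ?_
  filter_upwards [Filter.eventually_ge_atTop 1] with n hn
  rw [Real.norm_of_nonneg (by positivity), Real.norm_of_nonneg (by positivity)]
  have h1 : (1 : ℝ) ≤ n := by exact_mod_cast hn
  have h2 : ((n : ℝ) + 1) ^ 3 ≤ (2 * n) ^ 3 := by gcongr; linarith
  simp only [runTime]
  push_cast
  nlinarith

end RSCol

theorem mainTheorem5 :
    (∃ (M : Turing.TM2ComputableAux (Option Bool) Bool) (T : ℕ → ℕ),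
      ((fun n : ℕ => (T n : ℝ)) =O[Filter.atTop] fun n : ℕ => (n : ℝ) ^ 3) ∧
      RSCol.DecidesChordalInTime 3 M T) ∧
    Nonempty (Turing.TM2ComputableInPolyTime RSCol.ChordalInstance.encode
      Computability.encodeBool (RSCol.ChordalInstance.answer 3)) := by
  refine ⟨⟨RSCol.machineAux, RSCol.runTime, RSCol.runTime_isBigO, RSCol.machine_decides⟩,
    ⟨⟨RSCol.machineAux, Polynomial.C 40 * (Polynomial.X + 1) ^ 3, fun I => ?_⟩⟩⟩
  have h := (RSCol.machine_decides I).some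
  refine ⟨h.toEvalsTo, h.steps_le_m.trans ?_⟩
  -- The polynomial is evaluated at the input length `n * (n + 1)`, which is at least `n`, so
  -- monotonicity suffices.
  have hlen : I.1 ≤ I.encode.length := by
    rw [show I.encode.length = _ from RSCol.length_encodeGraph I.2.1]
    nlinarith
  simp only [Polynomial.eval_mul, Polynomial.eval_C, Polynomial.eval_pow, Polynomial.eval_add,
    Polynomial.eval_X, Polynomial.eval_one, RSCol.runTime]
  gcongr
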